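/- **Setting.** Fix $K\ge 1$ arms, a horizon $T\ge 0$, constants $b_0,\dots,b_{T-1}>0$ and $s_1,\dots,s_K\in\mathbb R$, a probability measure $\nu$ on $\mathbb R^K$ (the prior), and a policy $\pi=(\pi_t)_{t=0}^{T}$, i.e. Borel maps $\pi_t:(\mathbb R^K)^t\to\Delta_K$ into the probability simplex $\Delta_K$ that do not depend on $n$. *Batched experiment at scaling $n\in\mathbb N$.* Average rewards $h\sim\nu$ are drawn. Epoch $t=0,\dots,T-1$ has $b_tn$ units ($\lfloor b_tn\rfloor$ if $b_tn$ is not an integer). Unit $j$ of epoch $t$ has a vector of potential rewards $R^t_j=(R^t_{a,j})_{a}$, and $\xi^t_{a,j}\in\{0,1\}$ indicates whether arm $a$ is the one arm pulled for it. The scaled aggregate rewards are $$\sqrt n\,\bar R^n_{t,a}=\frac{1}{b_t\sqrt n}\sum_{j}\xi^t_{a,j}R^t_{a,j}.$$ Conditionally on $h$ and $\sqrt n\bar R^n_0,\dots,\sqrt n\bar R^n_{t-1}$: the pairs $(\xi^t_j,R^t_j)$ are independent over $j$; $\xi^t_j$ and $R^t_j$ are independent (ignorability); arm $a$ is pulled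 for unit $j$ with probability $\pi_{t,a}(\sqrt n\bar R^n_0,\dots,\sqrt n\bar R^n_{t-1})$ (sufficiency); and $R^t_j$ is distributed as $h/\sqrt n+\epsilon$. The law of the noise vector $\epsilon\in\mathbb R^K$ (which may depend on $n$ and $h$) satisfies $\mathbb E\,\epsilon_a=0$, $\operatorname{Var}(\epsilon_a)=s_a^2$ and $\mathbb E\|\epsilon\|_2^4\le C$, with $C$ independent of $n$ and $h$. Finally, given $h$ and all the $\sqrt n\bar R^n_t$, an arm $\hat a$ is drawn from $\pi_T(\sqrt n\bar R^n_0,\dots,\sqrt n\bar R^n_{T-1})$. *Gaussian sequential experiment.* $h\sim\nu$; for $t=0,\dots,T-1$, conditionally on $h,G_0,\dots,G_{t-1}$, $$G_t\sim N\Big(\big(\pi_{t,a}h_a\big)_{a},\ \operatorname{diag}\big(\pi_{t,a}s_a^2/b_t\big)_{a}\Big),\qquad \pi_{t}=\pi_{t}(G_0,\dots,G_{t-1});$$ and given $h,G_0,\dots,G_{T-1}$, an arm $\hat a$ is drawn from $\pi_T(G_0,\dots,G_{T-1})$. In either experiment the Bayes simple regret is $\mathrm{BSR}_T=\mathbb E\big[\max_a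 h_a-h_{\hat a}\big]$, the expectation being also over $h\sim\nu$. It is written $\mathrm{BSR}_T(\pi,\nu,\sqrt n\bar R^n)$ in the first and $\mathrm{BSR}_T(\pi,\nu,G)$ in the second. **Corollary.** Suppose that $\mathbb E_{h\sim\nu}\|h\|_1<\infty$ and that, for every $0\le t\le T$, the set of discontinuity points of $\pi_t$ has measure zero under the law of $(G_0,\dots,G_{t-1})$. Then $$\mathrm{BSR}_T(\pi,\nu,\sqrt n\bar R^n)\longrightarrow \mathrm{BSR}_T(\pi,\nu,G)\qquad (n\to\infty).$$ -/

import Mathlib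

open MeasureTheory ProbabilityTheory Filter Topology
open scoped ENNReal NNReal

noncomputable section

/-- An adaptive policy for `K` arms.  `prob t r` is the vector of sampling probabilities used after
observing the aggregate rewards `r 0, …, r (t - 1)`.  In an experiment with `T` epochs the epochs
`t < T` use `prob t`, the final selection uses `prob T`, and the later values play no role. -/
structure AdaptivePolicy (K : ℕ) where
  prob : (t : ℕ) → (Fin t → Fin K → ℝ) → Fin K → ℝ
  measurable_prob : ∀ t, Measurable (prob t)
  prob_mem : ∀ t r, prob t r ∈ stdSimplex ℝ (Fin K)

/-- The law on the arms that gives arm `a` the probability `p a`. -/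
def armLaw {K : ℕ} (p : Fin K → ℝ) : Measure (Fin K) :=
  ∑ a, ENNReal.ofReal (p a) • Measure.dirac a

/-- The observations of the epochs `0, …, t - 1`. -/
def history {K T : ℕ} {Ω : Type*} (obs : Fin T → Ω → Fin K → ℝ) (t : ℕ) (ht : t ≤ T) (ω : Ω) :
    Fin t → Fin K → ℝ :=
  fun i => obs (Fin.castLE ht i) ω

/-- The pair of the average rewards `h` and the observations of the epochs `0, …, t - 1`. -/
def past {K T : ℕ} {Ω : Type*} (h : Ω → Fin K → ℝ) (obs : Fin T → Ω → Fin K → ℝ)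
    (t : ℕ) (ht : t ≤ T) (ω : Ω) : (Fin K → ℝ) × (Fin t → Fin K → ℝ) :=
  (h ω, history obs t ht ω)

/-- Noise laws `Q n h` of the reward vector of one unit, at scaling `n` and average rewards `h`:
centered, with variance `s a ^ 2` for arm `a`, and with uniformly bounded fourth moment of the
Euclidean norm.  The noises of different arms may be dependent. -/
structure IsNoiseModel {K : ℕ} (s : Fin K → ℝ)
    (Q : ℕ → (Fin K → ℝ) → Measure (Fin K → ℝ)) : Prop where
  isProbabilityMeasure : ∀ n h, IsProbabilityMeasure (Q n h)
  mean_eq_zero : ∀ n h a, ∫ e, e a ∂(Q n h) = 0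
  variance_eq : ∀ n h a, Var[fun e => e a; Q n h] = s a ^ 2
  fourth_moment : ∃ C : ℝ≥0, ∀ n h,
    ∫⁻ e, ‖(WithLp.toLp 2 e : EuclideanSpace ℝ (Fin K))‖ₑ ^ 4 ∂(Q n h) ≤ C

/-- The number of units in epoch `t`; it is `b t * n` whenever this is an integer. -/
def batchSize {T : ℕ} (b : Fin T → ℝ) (n : ℕ) (t : Fin T) : ℕ := ⌊b t * n⌋₊

/-- The random variables of a batched experiment: the average rewards `h`, the arm pulled for
unit `j` of epoch `t`, the vector of potential rewards of this unit, and the arm selected at the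
end. -/
structure BatchedData (K T : ℕ) (b : Fin T → ℝ) (n : ℕ) (Ω : Type*) where
  h : Ω → Fin K → ℝ
  arm : (t : Fin T) → Fin (batchSize b n t) → Ω → Fin K
  reward : (t : Fin T) → Fin (batchSize b n t) → Ω → Fin K → ℝ
  choice : Ω → Fin K

/-- The scaled aggregate rewards `√n R̄ₜ`, whose coordinate `a` is
`(b t * √n)⁻¹ * ∑ j, ξ a j * R a j`, where `ξ a j` indicates that unit `j` pulled arm `a`. -/
def BatchedData.scaledMean {K T : ℕ} {b : Fin T → ℝ} {n : ℕ} {Ω : Type*}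
    (D : BatchedData K T b n Ω) (t : Fin T) (ω : Ω) (a : Fin K) : ℝ :=
  1 / (b t * √(n : ℝ)) *
    ∑ j, (if D.arm t j ω = a then (1 : ℝ) else 0) * D.reward t j ω a

/-- Given the average rewards and all observations, the final arm is drawn from `π.prob T`. -/
def IsFinalSelection {K T : ℕ} [NeZero K] {Ω : Type*} [MeasurableSpace Ω] (P : Measure Ω)
    [IsFiniteMeasure P] (π : AdaptivePolicy K) (h : Ω → Fin K → ℝ)
    (obs : Fin T → Ω → Fin K → ℝ) (choice : Ω → Fin K) : Prop :=
  ∀ᵐ x ∂(P.map (past h obs T le_rfl)),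
    condDistrib choice (past h obs T le_rfl) P x = armLaw (π.prob T x.2)

/-- The data `D` is a batched experiment, at scaling `n`, with prior `ν`, policy `π` and noise laws
`Q n`.  Conditional independence is expressed by regular conditional distributions, given the
average rewards and the scaled aggregate rewards of the earlier epochs. -/
structure IsBatchedExperiment {K T : ℕ} [NeZero K] {b : Fin T → ℝ} {n : ℕ} {Ω : Type*}
    [MeasurableSpace Ω] (P : Measure Ω) [IsProbabilityMeasure P]
    (ν : Measure (Fin K → ℝ)) (π : AdaptivePolicy K)
    (Q : ℕ → (Fin K → ℝ) → Measure (Fin K → ℝ)) (D : BatchedData K T b n Ω) : Prop where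
  measurable_h : Measurable D.h
  measurable_arm : ∀ t j, Measurable (D.arm t j)
  measurable_reward : ∀ t j, Measurable (D.reward t j)
  measurable_choice : Measurable D.choice
  /-- The average rewards are drawn from the prior. -/
  map_h : P.map D.h = ν
  /-- Different units of an epoch are conditionally independent. -/
  units_indep : ∀ t : Fin T, ∀ᵐ x ∂(P.map (past D.h D.scaledMean t t.isLt.le)),
    condDistrib (fun ω j => (D.arm t j ω, D.reward t j ω))
        (past D.h D.scaledMean t t.isLt.le) P x =
      Measure.pi fun j => condDistrib (fun ω => (D.arm t j ω, D.reward t j ω))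
        (past D.h D.scaledMean t t.isLt.le) P x
  /-- Ignorability: the pulled arm and the potential rewards of a unit are conditionally
  independent. -/
  ignorability : ∀ (t : Fin T) (j : Fin (batchSize b n t)),
    ∀ᵐ x ∂(P.map (past D.h D.scaledMean t t.isLt.le)),
      condDistrib (fun ω => (D.arm t j ω, D.reward t j ω))
          (past D.h D.scaledMean t t.isLt.le) P x =
        (condDistrib (D.arm t j) (past D.h D.scaledMean t t.isLt.le) P x).prod
          (condDistrib (D.reward t j) (past D.h D.scaledMean t t.isLt.le) P x)
  /-- Sufficiency: arms are drawn from the policy, evaluated at the scaled aggregate rewards. -/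
  arm_law : ∀ (t : Fin T) (j : Fin (batchSize b n t)),
    ∀ᵐ x ∂(P.map (past D.h D.scaledMean t t.isLt.le)),
      condDistrib (D.arm t j) (past D.h D.scaledMean t t.isLt.le) P x = armLaw (π.prob t x.2)
  /-- The potential rewards are distributed as `h / √n + ε`, where `ε` has the law `Q n h`. -/
  reward_law : ∀ (t : Fin T) (j : Fin (batchSize b n t)),
    ∀ᵐ x ∂(P.map (past D.h D.scaledMean t t.isLt.le)),
      condDistrib (D.reward t j) (past D.h D.scaledMean t t.isLt.le) P x =
        (Q n x.1).map fun e a => x.1 a / √(n : ℝ) + e a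
  /-- The final arm is drawn from the policy, evaluated at the scaled aggregate rewards. -/
  choice_law : IsFinalSelection P π D.h D.scaledMean D.choice

/-- The random variables of a Gaussian sequential experiment: the average rewards `h`, the
observations `G`, and the arm selected at the end. -/
structure GaussianData (K T : ℕ) (Ω : Type*) where
  h : Ω → Fin K → ℝ
  G : Fin T → Ω → Fin K → ℝ
  choice : Ω → Fin K

/-- The data `D` is a Gaussian sequential experiment with prior `ν` and policy `π`: given the
average rewards `h` and the earlier observations, `G t` is Gaussian with independent coordinates,
of mean `π t a * h a` and variance `π t a * s a ^ 2 / b t`. -/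
structure IsGaussianExperiment {K T : ℕ} [NeZero K] {Ω : Type*} [MeasurableSpace Ω]
    (P : Measure Ω) [IsProbabilityMeasure P] (b : Fin T → ℝ) (s : Fin K → ℝ)
    (ν : Measure (Fin K → ℝ)) (π : AdaptivePolicy K) (D : GaussianData K T Ω) : Prop where
  measurable_h : Measurable D.h
  measurable_G : ∀ t, Measurable (D.G t)
  measurable_choice : Measurable D.choice
  map_h : P.map D.h = ν
  G_law : ∀ t : Fin T, ∀ᵐ x ∂(P.map (past D.h D.G t t.isLt.le)),
    condDistrib (D.G t) (past D.h D.G t t.isLt.le) P x =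
      Measure.pi fun a => gaussianReal (π.prob t x.2 a * x.1 a)
        (Real.toNNReal (π.prob t x.2 a * s a ^ 2 / b t))
  choice_law : IsFinalSelection P π D.h D.G D.choice

/-- The Bayes simple regret: the expected gap between the best average reward and the average
reward of the selected arm, the average rewards being random. -/
def bayesSimpleRegret {K : ℕ} {Ω : Type*} [MeasurableSpace Ω] (P : Measure Ω)
    (h : Ω → Fin K → ℝ) (choice : Ω → Fin K) : ℝ :=
  ∫ ω, ((⨆ a, h ω a) - h ω (choice ω)) ∂P

end

/-!
The law of `(h, √n R̄₀, …, √n R̄ₜ₋₁)` converges weakly to that of `(h, G₀, …, Gₜ₋₁)`, by induction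
on `t`. The characteristic function of the joint law of the past and a new observation is the
integral, over the past, of a character times the conditional characteristic function of the new
observation. The latter is the `⌊b t * n⌋`-th power of the characteristic function of one unit. As
only one arm is pulled for a unit, this is an average over the arms of one-dimensional
characteristic functions; this is why dependence between the noises of different arms leaves no
trace in the limit. A second-order Taylor expansion bounds the distance of the power to the Gaussian
conditional characteristic function by `S h / √n` for some function `S`, and it is at most `2`
anyway, so it tends to `0` in mean, the law of `h` being the same for all `n`. The Gaussian
conditional characteristic function is a bounded function of the past that does not depend on `n`
and is continuous at almost every point of the limit law, so its integrals converge.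

The expected regret of the final selection given the past is almost everywhere continuous and
bounded by `2 ‖h‖`. As `h` has the same law in all experiments, truncating this regret costs an
error that is uniform in `n`, and weak convergence gives the convergence of the Bayes simple
regrets.
-/

section WeakConvergence

variable {X ι : Type*} [TopologicalSpace X] [MeasurableSpace X] [OpensMeasurableSpace X]
  [HasOuterApproxClosed X] {l : Filter ι} [l.IsCountablyGenerated]
  {μs : ι → ProbabilityMeasure X} {μ : ProbabilityMeasure X}

lemma tendsto_map_of_ae_continuousAt {Y : Type*} [TopologicalSpace Y] [MeasurableSpace Y]
    [OpensMeasurableSpace Y] (hμ : Tendsto μs l (𝓝 μ)) {g : X → Y} (hg : Measurable g)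
    (hgc : ∀ᵐ x ∂(μ : Measure X), ContinuousAt g x) :
    Tendsto (fun i => (μs i).map hg.aemeasurable) l (𝓝 (μ.map hg.aemeasurable)) := by
  refine tendsto_of_forall_isClosed_limsup_le' fun F hF => ?_
  simp only [ProbabilityMeasure.toMeasure_map, Measure.map_apply hg hF.measurableSet]
  calc limsup (fun i => (μs i : Measure X) (g ⁻¹' F)) l
      ≤ limsup (fun i => (μs i : Measure X) (closure (g ⁻¹' F))) l :=
        limsup_le_limsup (Eventually.of_forall fun i => measure_mono subset_closure)
    _ ≤ (μ : Measure X) (closure (g ⁻¹' F)) :=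
        ProbabilityMeasure.limsup_measure_closed_le_of_tendsto hμ isClosed_closure
    _ ≤ (μ : Measure X) (g ⁻¹' F) := by
        refine measure_mono_ae ?_
        filter_upwards [hgc] with x hx hxc
        have hgx : g x ∈ closure (g '' (g ⁻¹' F)) := hx.continuousWithinAt.mem_closure_image hxc
        exact hF.closure_subset_iff.2 (Set.image_preimage_subset g F) hgx

lemma tendsto_integral_of_ae_continuousAt {𝕜 : Type*} [RCLike 𝕜] (hμ : Tendsto μs l (𝓝 μ))
    {g : X → 𝕜} (hg : Measurable g) (hgc : ∀ᵐ x ∂(μ : Measure X), ContinuousAt g x)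
    {C : ℝ} (hC : ∀ x, ‖g x‖ ≤ C) :
    Tendsto (fun i => ∫ x, g x ∂(μs i : Measure X)) l (𝓝 (∫ x, g x ∂(μ : Measure X))) := by
  let g' : X → Metric.closedBall (0 : 𝕜) C := fun x => ⟨g x, by simpa using hC x⟩
  have hg' : Measurable g' := hg.subtype_mk
  have hgc' : ∀ᵐ x ∂(μ : Measure X), ContinuousAt g' x := by
    filter_upwards [hgc] with x hx
    exact Topology.IsInducing.subtypeVal.continuousAt_iff.2 hx
  have integral_coe (ρ : Measure X) : ∫ y, (y : 𝕜) ∂(ρ.map g') = ∫ x, g x ∂ρ :=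
    integral_map hg'.aemeasurable continuous_subtype_val.measurable.aestronglyMeasurable
  have hmap := (ProbabilityMeasure.tendsto_iff_forall_integral_rclike_tendsto 𝕜).1
    (tendsto_map_of_ae_continuousAt hμ hg' hgc')
    (BoundedContinuousFunction.mkOfCompact ⟨Subtype.val, continuous_subtype_val⟩)
  simpa only [ProbabilityMeasure.toMeasure_map, BoundedContinuousFunction.mkOfCompact_apply,
    ContinuousMap.coe_mk, integral_coe] using hmap

lemma abs_integral_sub_integral_clamp_le {α : Type*} [MeasurableSpace α] {ρ : Measure α}
    {g G : α → ℝ} (hg : AEStronglyMeasurable g ρ) (hgG : ∀ x, |g x| ≤ G x) (hG : Integrable G ρ)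
    {N : ℝ} (hN : 0 ≤ N) :
    |∫ x, g x ∂ρ - ∫ x, max (-N) (min (g x) N) ∂ρ| ≤ ∫ x, max (G x - N) 0 ∂ρ := by
  have hg_int : Integrable g ρ := hG.mono' hg (Eventually.of_forall hgG)
  have hclamp (y : ℝ) : |max (-N) (min y N)| ≤ |y| := by grind
  have hclamp_int : Integrable (fun x => max (-N) (min (g x) N)) ρ :=
    hG.mono' (aestronglyMeasurable_const.sup (hg.inf aestronglyMeasurable_const))
      (Eventually.of_forall fun x => (hclamp (g x)).trans (hgG x))
  rw [← integral_sub hg_int hclamp_int]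
  refine norm_integral_le_of_norm_le (f := fun x => g x - _)
    (hG.mono (by fun_prop) (Eventually.of_forall fun x => ?_)) (Eventually.of_forall fun x => ?_)
  · have := (abs_nonneg _).trans (hgG x)
    simp only [Real.norm_eq_abs]; grind
  · have := hgG x
    simp only [Real.norm_eq_abs]; grind

lemma tendsto_integral_max_sub_zero {α : Type*} [MeasurableSpace α] {ρ : Measure α} {G : α → ℝ}
    (hG : Integrable G ρ) :
    Tendsto (fun N : ℕ => ∫ x, max (G x - N) 0 ∂ρ) atTop (𝓝 0) := by
  have hlim (x : α) : Tendsto (fun N : ℕ => max (G x - N) 0) atTop (𝓝 0) := by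
    obtain ⟨N₀, hN₀⟩ := exists_nat_ge (G x)
    refine tendsto_const_nhds.congr' ?_
    filter_upwards [eventually_ge_atTop N₀] with N hN
    have : (N₀ : ℝ) ≤ N := by exact_mod_cast hN
    rw [max_eq_right (by linarith)]
  simpa using tendsto_integral_of_dominated_convergence (fun x => |G x|)
    (fun N => by have := hG.aestronglyMeasurable; fun_prop) hG.abs
    (fun N => Eventually.of_forall fun x => by
      have : (0 : ℝ) ≤ N := N.cast_nonneg
      simp only [Real.norm_eq_abs]; grind)
    (Eventually.of_forall hlim)

lemma tendsto_integral_of_ae_continuousAt_of_identDistrib (hμ : Tendsto μs l (𝓝 μ))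
    {g G : X → ℝ} (hg : Measurable g) (hgc : ∀ᵐ x ∂(μ : Measure X), ContinuousAt g x)
    (hgG : ∀ x, |g x| ≤ G x) (hG : Integrable G (μ : Measure X))
    (hid : ∀ i, IdentDistrib G G (μs i : Measure X) (μ : Measure X)) :
    Tendsto (fun i => ∫ x, g x ∂(μs i : Measure X)) l (𝓝 (∫ x, g x ∂(μ : Measure X))) := by
  have htail (i : ι) (N : ℕ) :
      ∫ x, max (G x - N) 0 ∂(μs i : Measure X) = ∫ x, max (G x - N) 0 ∂(μ : Measure X) :=
    ((hid i).comp (u := fun y : ℝ => max (y - N) 0) (by fun_prop)).integral_eq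
  have htail_zero := tendsto_integral_max_sub_zero hG
  refine TendstoUniformly.tendsto_of_eventually_tendsto (p := atTop)
    (F := fun (N : ℕ) i => ∫ x, max (-N : ℝ) (min (g x) N) ∂(μs i : Measure X))
    (L := fun N : ℕ => ∫ x, max (-N : ℝ) (min (g x) N) ∂(μ : Measure X)) ?_
    (Eventually.of_forall fun N => ?_) ?_
  · refine Metric.tendstoUniformly_iff.2 fun δ hδ => ?_
    filter_upwards [htail_zero.eventually (gt_mem_nhds hδ)] with N hN i
    rw [Real.dist_eq]
    refine (abs_integral_sub_integral_clamp_le hg.aestronglyMeasurable hgG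
      ((hid i).integrable_iff.2 hG) N.cast_nonneg).trans_lt ?_
    rwa [htail i N]
  · refine tendsto_integral_of_ae_continuousAt hμ (by fun_prop) ?_ (C := N) fun x => ?_
    · filter_upwards [hgc] with x hx
      exact continuousAt_const.max (hx.min continuousAt_const)
    · have : (0 : ℝ) ≤ N := N.cast_nonneg
      simp only [Real.norm_eq_abs]; grind
  · refine tendsto_iff_dist_tendsto_zero.2 (squeeze_zero (fun _ => dist_nonneg) (fun N => ?_)
      htail_zero)
    rw [dist_comm, Real.dist_eq]
    exact abs_integral_sub_integral_clamp_le hg.aestronglyMeasurable hgG hG N.cast_nonneg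

end WeakConvergence

section CharacteristicFunction

lemma charFun_map_toEuclidean {E : Type*} [NormedAddCommGroup E] [NormedSpace ℝ E]
    [FiniteDimensional ℝ E] [MeasurableSpace E] [BorelSpace E] (μ : Measure E)
    (t : EuclideanSpace ℝ (Fin (Module.finrank ℝ E))) :
    charFun (μ.map toEuclidean) t =
      charFunDual μ
        ((InnerProductSpace.toDualMap ℝ _ t).comp (toEuclidean (E := E) : E →L[ℝ] _)) := by
  rw [charFun_eq_charFunDual_toDualMap, ← charFunDual_map]
  rfl

lemma tendsto_of_tendsto_charFunDual {E : Type*} [NormedAddCommGroup E] [NormedSpace ℝ E]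
    [FiniteDimensional ℝ E] [MeasurableSpace E] [BorelSpace E]
    {μs : ℕ → ProbabilityMeasure E} {μ : ProbabilityMeasure E}
    (h : ∀ L : StrongDual ℝ E,
      Tendsto (fun n => charFunDual (μs n : Measure E) L) atTop (𝓝 (charFunDual μ L))) :
    Tendsto μs atTop (𝓝 μ) := by
  have he : Measurable (toEuclidean (E := E)) := toEuclidean.continuous.measurable
  have hmap : Tendsto (fun n => (μs n).map he.aemeasurable) atTop (𝓝 (μ.map he.aemeasurable)) :=
    ProbabilityMeasure.tendsto_of_tendsto_charFun fun t => by
      simpa only [ProbabilityMeasure.toMeasure_map, charFun_map_toEuclidean] using h _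
  have hsymm := ProbabilityMeasure.tendsto_map_of_tendsto_of_continuous _ _ hmap
    (toEuclidean (E := E)).symm.continuous
  have map_symm_map (ρ : ProbabilityMeasure E) : (ρ.map he.aemeasurable).map
      (toEuclidean (E := E)).symm.continuous.measurable.aemeasurable = ρ := by
    apply Subtype.ext
    change ((ρ : Measure E).map toEuclidean).map (toEuclidean (E := E)).symm = ρ
    rw [Measure.map_map (toEuclidean (E := E)).symm.continuous.measurable he]
    simp
  simpa only [map_symm_map] using hsymm

lemma norm_charFunDual_le_one {E : Type*} [NormedAddCommGroup E] [NormedSpace ℝ E]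
    [MeasurableSpace E] (μ : Measure E) [IsProbabilityMeasure μ] (L : StrongDual ℝ E) :
    ‖charFunDual μ L‖ ≤ 1 := by
  simpa [charFunDual_apply] using norm_integral_le_of_norm_le_const (μ := μ)
    (Eventually.of_forall fun v => (Complex.norm_exp_ofReal_mul_I (L v)).le)

lemma measurable_charFunDual_kernel {α E : Type*} [MeasurableSpace α] [NormedAddCommGroup E]
    [NormedSpace ℝ E] [MeasurableSpace E] [OpensMeasurableSpace E] (κ : Kernel α E)
    (L : StrongDual ℝ E) : Measurable fun x => charFunDual (κ x) L :=
  (StronglyMeasurable.integral_kernel (κ := κ) (Measurable.stronglyMeasurable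
    (f := fun v => Complex.exp (L v * Complex.I)) (by fun_prop))).measurable

lemma charFunDual_map_prodMk {E F Ω : Type*} [NormedAddCommGroup E] [NormedSpace ℝ E]
    [MeasurableSpace E] [BorelSpace E] [NormedAddCommGroup F] [NormedSpace ℝ F]
    [FiniteDimensional ℝ F] [MeasurableSpace F] [BorelSpace F] [MeasurableSpace Ω]
    {P : Measure Ω} [IsFiniteMeasure P] (X : Ω → E) {Y : Ω → F} (hY : AEMeasurable Y P)
    (L : StrongDual ℝ (E × F)) :
    charFunDual (P.map fun ω => (X ω, Y ω)) L =
      ∫ x, Complex.exp (L (x, 0) * Complex.I) *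
        charFunDual (condDistrib Y X P x) (L.comp (.inr ℝ E F)) ∂(P.map X) := by
  rw [charFunDual_apply, ← compProd_map_condDistrib hY, Measure.integral_compProd]
  · simp only [charFunDual_apply, ← integral_const_mul, ← Complex.exp_add, ← add_mul,
      ContinuousLinearMap.comp_apply, ContinuousLinearMap.inr_apply, ← Complex.ofReal_add,
      ← map_add, Prod.mk_add_mk, add_zero, zero_add]
  · exact Integrable.of_bound (C := 1) (by fun_prop)
      (Eventually.of_forall fun z => (Complex.norm_exp_ofReal_mul_I _).le)

lemma norm_charFunDual_map_prodMk_sub_le {E F Ω : Type*} [NormedAddCommGroup E] [NormedSpace ℝ E]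
    [MeasurableSpace E] [BorelSpace E] [NormedAddCommGroup F] [NormedSpace ℝ F]
    [FiniteDimensional ℝ F] [MeasurableSpace F] [BorelSpace F] [MeasurableSpace Ω]
    {P : Measure Ω} [IsFiniteMeasure P] (X : Ω → E) {Y : Ω → F} (hY : AEMeasurable Y P)
    (L : StrongDual ℝ (E × F)) {ψ : E → ℂ} (hψ : Measurable ψ) (hψ_le : ∀ x, ‖ψ x‖ ≤ 1) :
    ‖charFunDual (P.map fun ω => (X ω, Y ω)) L -
        ∫ x, Complex.exp (L (x, 0) * Complex.I) * ψ x ∂(P.map X)‖ ≤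
      ∫ x, ‖charFunDual (condDistrib Y X P x) (L.comp (.inr ℝ E F)) - ψ x‖ ∂(P.map X) := by
  have hexp : Measurable fun x : E => Complex.exp (L (x, 0) * Complex.I) := by fun_prop
  have hκ := measurable_charFunDual_kernel (condDistrib Y X P) (L.comp (.inr ℝ E F))
  rw [charFunDual_map_prodMk X hY, ← integral_sub]
  · refine (norm_integral_le_integral_norm _).trans_eq (integral_congr_ae
      (Eventually.of_forall fun x => ?_))
    simp only [← mul_sub, norm_mul, Complex.norm_exp_ofReal_mul_I, one_mul]
  · exact Integrable.of_bound (C := 1) (hexp.mul hκ).aestronglyMeasurable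
      (Eventually.of_forall fun x => by
        simpa [Complex.norm_exp_ofReal_mul_I] using norm_charFunDual_le_one _ _)
  · exact Integrable.of_bound (C := 1) (hexp.mul hψ).aestronglyMeasurable
      (Eventually.of_forall fun x => by simpa [Complex.norm_exp_ofReal_mul_I] using hψ_le x)

lemma tendstoInDistribution_prodMk_of_charFunDual_condDistrib {E F : Type*}
    [NormedAddCommGroup E] [NormedSpace ℝ E] [FiniteDimensional ℝ E] [MeasurableSpace E]
    [BorelSpace E] [NormedAddCommGroup F] [NormedSpace ℝ F] [FiniteDimensional ℝ F]
    [MeasurableSpace F] [BorelSpace F]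
    {Ω : ℕ → Type*} [∀ n, MeasurableSpace (Ω n)] {P : ∀ n, Measure (Ω n)}
    [∀ n, IsProbabilityMeasure (P n)] {Ω' : Type*} [MeasurableSpace Ω'] {P' : Measure Ω'}
    [IsProbabilityMeasure P'] {X : ∀ n, Ω n → E} {X' : Ω' → E} {Y : ∀ n, Ω n → F} {Y' : Ω' → F}
    (hX : TendstoInDistribution X atTop X' P P') (hY : ∀ n, AEMeasurable (Y n) (P n))
    (hY' : AEMeasurable Y' P') {ψ : StrongDual ℝ F → E → ℂ} (hψ : ∀ L, Measurable (ψ L))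
    (hψ_le : ∀ L x, ‖ψ L x‖ ≤ 1) (hψ_cont : ∀ L, ∀ᵐ x ∂(P'.map X'), ContinuousAt (ψ L) x)
    (hlim : ∀ L, Tendsto (fun n =>
      ∫ x, ‖charFunDual (condDistrib (Y n) (X n) (P n) x) L - ψ L x‖ ∂((P n).map (X n)))
      atTop (𝓝 0))
    (hψ_eq : ∀ L, ∀ᵐ x ∂(P'.map X'), charFunDual (condDistrib Y' X' P' x) L = ψ L x) :
    TendstoInDistribution (fun n ω => (X n ω, Y n ω)) atTop (fun ω => (X' ω, Y' ω)) P P' := by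
  refine ⟨fun n => (hX.forall_aemeasurable n).prodMk (hY n), hX.aemeasurable_limit.prodMk hY',
    tendsto_of_tendsto_charFunDual fun L => ?_⟩
  let L₂ := L.comp (.inr ℝ E F)
  let g (x : E) : ℂ := Complex.exp (L (x, 0) * Complex.I) * ψ L₂ x
  have hg_le (x : E) : ‖g x‖ ≤ 1 := by
    simpa [g, Complex.norm_exp_ofReal_mul_I] using hψ_le L₂ x
  have hg_cont : ∀ᵐ x ∂(P'.map X'), ContinuousAt g x :=
    (hψ_cont L₂).mono fun x hx => (by fun_prop : ContinuousAt _ x).mul hx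
  have hlimit : Tendsto (fun n => ∫ x, g x ∂((P n).map (X n))) atTop
      (𝓝 (∫ x, g x ∂(P'.map X'))) :=
    tendsto_integral_of_ae_continuousAt hX.tendsto
      ((by fun_prop : Measurable fun x : E => _).mul (hψ L₂)) hg_cont hg_le
  have hcharFun' : charFunDual (P'.map fun ω => (X' ω, Y' ω)) L = ∫ x, g x ∂(P'.map X') := by
    rw [charFunDual_map_prodMk X' hY']
    exact integral_congr_ae ((hψ_eq L₂).mono fun x hx => congrArg (_ * ·) hx)
  change Tendsto (fun n => charFunDual ((P n).map fun ω => (X n ω, Y n ω)) L) atTop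
    (𝓝 (charFunDual (P'.map fun ω => (X' ω, Y' ω)) L))
  rw [hcharFun']
  have hdiff := squeeze_zero_norm (fun n => norm_charFunDual_map_prodMk_sub_le (X n) (hY n) L
    (hψ L₂) (hψ_le L₂)) (hlim L₂)
  simpa only [g, sub_add_cancel, zero_add] using hdiff.add hlimit

end CharacteristicFunction

section ComplexExponential

lemma norm_cexp_mul_I_sub_taylor_le (x : ℝ) :
    ‖Complex.exp (x * Complex.I) - (1 + x * Complex.I - x ^ 2 / 2)‖ ≤ 4 * |x| ^ 3 := by
  rcases le_or_gt |x| 1 with hx | hx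
  · have htaylor := Complex.exp_bound (x := x * Complex.I) (by simpa using hx) (n := 3)
      (by norm_num)
    have hsum : ∑ m ∈ Finset.range 3, ((x : ℂ) * Complex.I) ^ m / (m.factorial : ℂ) =
        1 + x * Complex.I - x ^ 2 / 2 := by
      simp only [Finset.sum_range_succ, Finset.sum_range_zero]
      norm_num [mul_pow, Nat.factorial]
      ring
    rw [hsum, norm_mul, Complex.norm_I, mul_one, Complex.norm_real, Real.norm_eq_abs,
      mul_comm (|x| ^ 3)] at htaylor
    refine htaylor.trans ?_
    gcongr
    norm_num [Nat.factorial]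
  · calc ‖Complex.exp (x * Complex.I) - (1 + x * Complex.I - x ^ 2 / 2)‖
        ≤ ‖Complex.exp (x * Complex.I)‖ + (‖(1 : ℂ)‖ + ‖(x : ℂ) * Complex.I‖ +
            ‖(x : ℂ) ^ 2 / 2‖) :=
          (norm_sub_le _ _).trans
            (by gcongr; exact (norm_sub_le _ _).trans (by gcongr; exact norm_add_le _ _))
      _ = 2 + |x| + |x| ^ 2 / 2 := by
          simp only [Complex.norm_exp_ofReal_mul_I, norm_one, norm_mul, Complex.norm_I, norm_div,
            norm_pow, Complex.norm_real, Real.norm_eq_abs, Complex.norm_ofNat]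
          ring
      _ ≤ 4 * |x| ^ 3 := by
          have hx2 : |x| ≤ |x| ^ 2 := le_self_pow₀ hx.le two_ne_zero
          have hx3 : |x| ^ 2 ≤ |x| ^ 3 := pow_le_pow_right₀ hx.le (by norm_num)
          linarith

lemma norm_cexp_le_one_of_re_nonpos {z : ℂ} (hz : z.re ≤ 0) : ‖Complex.exp z‖ ≤ 1 := by
  rw [Complex.norm_exp]
  exact Real.exp_le_one_iff.2 hz

lemma norm_cexp_sub_one_le_of_re_nonpos {z : ℂ} (hz : z.re ≤ 0) :
    ‖Complex.exp z - 1‖ ≤ 2 * ‖z‖ := by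
  rcases le_or_gt ‖z‖ 1 with h | h
  · exact Complex.norm_exp_sub_one_le h
  · calc ‖Complex.exp z - 1‖ ≤ ‖Complex.exp z‖ + ‖(1 : ℂ)‖ := norm_sub_le _ _
      _ ≤ 1 + 1 := by gcongr; exacts [norm_cexp_le_one_of_re_nonpos hz, norm_one.le]
      _ ≤ 2 * ‖z‖ := by linarith

lemma norm_cexp_sub_one_sub_id_le_of_re_nonpos {z : ℂ} (hz : z.re ≤ 0) :
    ‖Complex.exp z - 1 - z‖ ≤ 3 * ‖z‖ ^ 2 := by
  rcases le_or_gt ‖z‖ 1 with h | h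
  · exact (Complex.norm_exp_sub_one_sub_id_le h).trans (by nlinarith [sq_nonneg ‖z‖])
  · calc ‖Complex.exp z - 1 - z‖ ≤ ‖Complex.exp z - 1‖ + ‖z‖ := norm_sub_le _ _
      _ ≤ 2 * ‖z‖ + ‖z‖ := by gcongr; exact norm_cexp_sub_one_le_of_re_nonpos hz
      _ ≤ 3 * ‖z‖ ^ 2 := by nlinarith

lemma norm_pow_sub_pow_le_of_norm_le_one {R : Type*} [NormedCommRing R] [NormOneClass R] {z w : R}
    (hz : ‖z‖ ≤ 1) (hw : ‖w‖ ≤ 1) (m : ℕ) : ‖z ^ m - w ^ m‖ ≤ m * ‖z - w‖ := by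
  induction m with
  | zero => simp
  | succ m ih =>
    have hzm : ‖z ^ m‖ ≤ 1 := (norm_pow_le z m).trans (pow_le_one₀ (norm_nonneg z) hz)
    calc ‖z ^ (m + 1) - w ^ (m + 1)‖ = ‖z ^ m * (z - w) + (z ^ m - w ^ m) * w‖ := by ring_nf
      _ ≤ ‖z ^ m‖ * ‖z - w‖ + ‖z ^ m - w ^ m‖ * ‖w‖ :=
          (norm_add_le _ _).trans (add_le_add (norm_mul_le _ _) (norm_mul_le _ _))
      _ ≤ 1 * ‖z - w‖ + m * ‖z - w‖ * 1 := by gcongr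
      _ = (m + 1 : ℕ) * ‖z - w‖ := by push_cast; ring

lemma norm_cexp_pow_sub_cexp_le {z : ℂ} (hz : z.re ≤ 0) {δ : ℝ} (hδ : 0 ≤ δ) {m : ℕ}
    (hm : m * δ ≤ 1) (hm' : 1 ≤ m * δ + δ) :
    ‖Complex.exp (δ * z) ^ m - Complex.exp z‖ ≤ 2 * δ * ‖z‖ := by
  have hre {r : ℝ} (hr : 0 ≤ r) : ((r : ℂ) * z).re ≤ 0 := by
    rw [Complex.re_ofReal_mul]; exact mul_nonpos_of_nonneg_of_nonpos hr hz
  have hfactor : Complex.exp (δ * z) ^ m - Complex.exp z =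
      -(Complex.exp ((m * δ : ℝ) * z) * (Complex.exp ((1 - m * δ : ℝ) * z) - 1)) := by
    rw [← Complex.exp_nat_mul, mul_sub, ← Complex.exp_add]
    push_cast
    ring_nf
  calc ‖Complex.exp (δ * z) ^ m - Complex.exp z‖
      ≤ 1 * (2 * ‖((1 - m * δ : ℝ) : ℂ) * z‖) := by
        rw [hfactor, norm_neg, norm_mul]
        gcongr
        · exact norm_cexp_le_one_of_re_nonpos (hre (by positivity))
        · exact norm_cexp_sub_one_le_of_re_nonpos (hre (by linarith))
    _ = 2 * ((1 - m * δ) * ‖z‖) := by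
        rw [norm_mul, Complex.norm_real, Real.norm_of_nonneg (by linarith), one_mul]
    _ ≤ 2 * (δ * ‖z‖) := by gcongr; linarith
    _ = 2 * δ * ‖z‖ := by ring

/-- The array version of `(1 + z / m) ^ m → exp z`, where `δ` plays the role of `1 / m`. -/
lemma norm_pow_sub_cexp_le {φ z : ℂ} (hφ : ‖φ‖ ≤ 1) (hz : z.re ≤ 0) {δ : ℝ} (hδ : 0 ≤ δ) {m : ℕ}
    (hm : m * δ ≤ 1) (hm' : 1 ≤ m * δ + δ) :
    ‖φ ^ m - Complex.exp z‖ ≤ m * (‖φ - 1 - δ * z‖ + 3 * δ ^ 2 * ‖z‖ ^ 2) + 2 * δ * ‖z‖ := by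
  have hre : ((δ : ℂ) * z).re ≤ 0 := by
    rw [Complex.re_ofReal_mul]; exact mul_nonpos_of_nonneg_of_nonpos hδ hz
  have hbase : ‖φ - Complex.exp (δ * z)‖ ≤ ‖φ - 1 - δ * z‖ + 3 * δ ^ 2 * ‖z‖ ^ 2 :=
    calc ‖φ - Complex.exp (δ * z)‖ = ‖(φ - 1 - δ * z) - (Complex.exp (δ * z) - 1 - δ * z)‖ := by
          ring_nf
      _ ≤ ‖φ - 1 - δ * z‖ + 3 * ‖δ * z‖ ^ 2 :=
          (norm_sub_le _ _).trans (by gcongr; exact norm_cexp_sub_one_sub_id_le_of_re_nonpos hre)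
      _ = ‖φ - 1 - δ * z‖ + 3 * δ ^ 2 * ‖z‖ ^ 2 := by
          rw [norm_mul, Complex.norm_real, Real.norm_of_nonneg hδ]; ring
  calc ‖φ ^ m - Complex.exp z‖
      ≤ ‖φ ^ m - Complex.exp (δ * z) ^ m‖ + ‖Complex.exp (δ * z) ^ m - Complex.exp z‖ :=
        norm_sub_le_norm_sub_add_norm_sub ..
    _ ≤ m * ‖φ - Complex.exp (δ * z)‖ + 2 * δ * ‖z‖ :=
        add_le_add (norm_pow_sub_pow_le_of_norm_le_one hφ (norm_cexp_le_one_of_re_nonpos hre) m)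
          (norm_cexp_pow_sub_cexp_le hz hδ hm hm')
    _ ≤ _ := by gcongr

end ComplexExponential

section Moments

variable {Ω : Type*} [MeasurableSpace Ω] {P : Measure Ω}

lemma integral_abs_pow_three_eq_lpNorm {X : Ω → ℝ} (hX : AEStronglyMeasurable X P) :
    ∫ ω, |X ω| ^ 3 ∂P = lpNorm X 3 P ^ 3 := by
  have h := lpNorm_nnreal_eq_integral_norm_rpow (p := 3) (by norm_num) hX
  rw [show ((3 : ℝ≥0) : ℝ≥0∞) = 3 by norm_num] at h
  rw [h, ← Real.rpow_mul_natCast (integral_nonneg fun _ => by positivity)]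
  norm_num

variable [IsProbabilityMeasure P]

lemma norm_integral_cexp_sub_taylor_le {X : Ω → ℝ} (hX : MemLp X 3 P) :
    ‖∫ ω, Complex.exp (X ω * Complex.I) ∂P -
        (1 + (∫ ω, X ω ∂P : ℝ) * Complex.I - (∫ ω, X ω ^ 2 ∂P : ℝ) / 2)‖ ≤
      4 * lpNorm X 3 P ^ 3 := by
  have hX1 : Integrable (fun ω => (X ω : ℂ) * Complex.I) P :=
    (hX.integrable (by norm_num)).ofReal.mul_const _
  have hX2 : Integrable (fun ω => ((X ω ^ 2 : ℝ) : ℂ) / 2) P :=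
    (hX.mono_exponent (by norm_num)).integrable_sq.ofReal.div_const 2
  have hX01 : Integrable (fun ω => 1 + (X ω : ℂ) * Complex.I) P := (integrable_const 1).add hX1
  have hX012 : Integrable (fun ω => 1 + (X ω : ℂ) * Complex.I - ((X ω ^ 2 : ℝ) : ℂ) / 2) P :=
    hX01.sub hX2
  have hX3 : Integrable (fun ω => |X ω| ^ 3) P := hX.integrable_norm_pow (p := 3) (by norm_num)
  have hexp : Integrable (fun ω => Complex.exp (X ω * Complex.I)) P := by
    refine Integrable.of_bound (C := 1) ?_
      (Eventually.of_forall fun ω => (Complex.norm_exp_ofReal_mul_I _).le)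
    exact (by fun_prop : Continuous fun x : ℝ => Complex.exp (x * Complex.I))
      |>.comp_aestronglyMeasurable hX.aestronglyMeasurable
  have hpoly : ∫ ω, (1 + (X ω : ℂ) * Complex.I - ((X ω ^ 2 : ℝ) : ℂ) / 2) ∂P =
      1 + (∫ ω, X ω ∂P : ℝ) * Complex.I - (∫ ω, X ω ^ 2 ∂P : ℝ) / 2 := by
    rw [integral_sub hX01 hX2, integral_add (integrable_const 1) hX1,
      integral_mul_const, integral_div, integral_complex_ofReal, integral_complex_ofReal]
    simp
  rw [← hpoly, ← integral_sub hexp hX012,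
    ← integral_abs_pow_three_eq_lpNorm hX.aestronglyMeasurable, ← integral_const_mul]
  refine norm_integral_le_of_norm_le (hX3.const_mul 4) (Eventually.of_forall fun ω => ?_)
  simpa only [Complex.ofReal_pow] using norm_cexp_mul_I_sub_taylor_le (X ω)

lemma lpNorm_const_mul_const_add_le (Z : Ω → ℝ) {p : ℝ≥0∞} (hp : 1 ≤ p) (c d : ℝ) :
    lpNorm (fun ω => c * (d + Z ω)) p P ≤ |c| * (|d| + lpNorm Z p P) := by
  have hp0 : p ≠ 0 := (one_pos.trans_le hp).ne'
  calc lpNorm (fun ω => c * (d + Z ω)) p P = |c| * lpNorm ((fun _ => d) + Z) p P :=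
        lpNorm_const_smul c _ P
    _ ≤ |c| * (lpNorm (fun _ => d) p P + lpNorm Z p P) := by
        gcongr; exact lpNorm_add_le (memLp_const d) hp
    _ = |c| * (|d| + lpNorm Z p P) := by
        simp [lpNorm_const hp0 (IsProbabilityMeasure.ne_zero P)]

lemma integral_mul_const_add {Z : Ω → ℝ} (hZ : Integrable Z P) (c d : ℝ) :
    ∫ ω, c * (d + Z ω) ∂P = c * (d + ∫ ω, Z ω ∂P) := by
  simp only [integral_const_mul, integral_add (integrable_const d) hZ, integral_const,
    probReal_univ, one_smul]

lemma integral_mul_const_add_sq {Z : Ω → ℝ} (hZ : MemLp Z 2 P) (c d : ℝ) :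
    ∫ ω, (c * (d + Z ω)) ^ 2 ∂P = c ^ 2 * Var[Z; P] + (c * (d + ∫ ω, Z ω ∂P)) ^ 2 := by
  have hshift : MemLp (fun ω => d + Z ω) 2 P := (memLp_const d).add hZ
  have hvar := variance_eq_sub (hshift.const_mul c)
  simp only [Pi.pow_apply, integral_mul_const_add (hZ.integrable (by norm_num)),
    variance_const_mul, variance_const_add hZ.aestronglyMeasurable] at hvar
  linarith

lemma norm_integral_cexp_scaled_shift_sub_le {Z : Ω → ℝ} (hZ : MemLp Z 3 P)
    (hmean : ∫ ω, Z ω ∂P = 0) {σ : ℝ} (hvar : Var[Z; P] = σ ^ 2) {ε : ℝ} (hε0 : 0 ≤ ε)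
    (hε1 : ε ≤ 1) (w h : ℝ) :
    ‖∫ ω, Complex.exp ((ε * w * (ε * h + Z ω) : ℝ) * Complex.I) ∂P - 1 -
        (ε ^ 2 : ℝ) * (w * h * Complex.I - w ^ 2 * σ ^ 2 / 2)‖ ≤
      ε ^ 3 * (|w| ^ 2 * |h| ^ 2 + 4 * |w| ^ 3 * (|h| + lpNorm Z 3 P) ^ 3) := by
  let X : Ω → ℝ := fun ω => ε * w * (ε * h + Z ω)
  have hshift : MemLp (fun ω => ε * h + Z ω) 3 P := (memLp_const (ε * h)).add hZ
  have hX : MemLp X 3 P := hshift.const_mul (ε * w)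
  have hX_mean : ∫ ω, X ω ∂P = ε ^ 2 * (w * h) := by
    rw [integral_mul_const_add (hZ.integrable (by norm_num)), hmean]
    ring
  have hX_sq : ∫ ω, X ω ^ 2 ∂P = ε ^ 2 * (w ^ 2 * σ ^ 2) + (ε ^ 2 * (w * h)) ^ 2 := by
    rw [integral_mul_const_add_sq (hZ.mono_exponent (by norm_num)), hmean, hvar]
    ring
  have hX_lpNorm : lpNorm X 3 P ≤ ε * |w| * (|h| + lpNorm Z 3 P) := by
    refine (lpNorm_const_mul_const_add_le Z (by norm_num) (ε * w) (ε * h)).trans ?_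
    rw [abs_mul, abs_mul, abs_of_nonneg hε0]
    gcongr
    exact mul_le_of_le_one_left (abs_nonneg h) hε1
  have hquartic : ‖(((ε ^ 2 * (w * h)) ^ 2 / 2 : ℝ) : ℂ)‖ ≤ ε ^ 3 * (|w| ^ 2 * |h| ^ 2) := by
    rw [Complex.norm_real, Real.norm_of_nonneg (by positivity), sq_abs, sq_abs]
    have hε4 : ε ^ 4 ≤ ε ^ 3 := pow_le_pow_of_le_one hε0 hε1 (by norm_num)
    calc (ε ^ 2 * (w * h)) ^ 2 / 2 ≤ ε ^ 4 * (w ^ 2 * h ^ 2) := by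
          nlinarith [sq_nonneg (ε ^ 2 * (w * h))]
      _ ≤ ε ^ 3 * (w ^ 2 * h ^ 2) := by gcongr
  have htaylor := norm_integral_cexp_sub_taylor_le hX
  rw [hX_mean, hX_sq] at htaylor
  calc ‖∫ ω, Complex.exp (X ω * Complex.I) ∂P - 1 -
        (ε ^ 2 : ℝ) * (w * h * Complex.I - w ^ 2 * σ ^ 2 / 2)‖
      = ‖(∫ ω, Complex.exp (X ω * Complex.I) ∂P - _) - (((ε ^ 2 * (w * h)) ^ 2 / 2 : ℝ) : ℂ)‖ := by
        push_cast; congr 1; ring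
    _ ≤ 4 * lpNorm X 3 P ^ 3 + ε ^ 3 * (|w| ^ 2 * |h| ^ 2) :=
        (norm_sub_le _ _).trans (add_le_add htaylor hquartic)
    _ ≤ 4 * (ε * |w| * (|h| + lpNorm Z 3 P)) ^ 3 + ε ^ 3 * (|w| ^ 2 * |h| ^ 2) := by
        have := lpNorm_nonneg (f := X) (p := 3) (μ := P)
        gcongr
    _ = _ := by ring

end Moments

section NoiseMoments

lemma enorm_apply_le_enorm_toLp {ι : Type*} [Fintype ι] (e : ι → ℝ) (a : ι) :
    ‖e a‖ₑ ≤ ‖(WithLp.toLp 2 e : EuclideanSpace ℝ ι)‖ₑ := by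
  rw [enorm_le_iff_norm_le]
  exact PiLp.norm_apply_le (WithLp.toLp 2 e : EuclideanSpace ℝ ι) a

lemma IsNoiseModel.exists_lpNorm_le {K : ℕ} {s : Fin K → ℝ}
    {Q : ℕ → (Fin K → ℝ) → Measure (Fin K → ℝ)} (hQ : IsNoiseModel s Q) :
    ∃ M : ℝ, ∀ n h a, MemLp (fun e => e a) 3 (Q n h) ∧ lpNorm (fun e => e a) 3 (Q n h) ≤ M := by
  obtain ⟨C, hC⟩ := hQ.fourth_moment
  refine ⟨((C : ℝ≥0∞) ^ (4 : ℝ)⁻¹).toReal, fun n h a => ?_⟩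
  have := hQ.isProbabilityMeasure n h
  have hcoord : AEStronglyMeasurable (fun e : Fin K → ℝ => e a) (Q n h) :=
    (measurable_pi_apply a).aestronglyMeasurable
  have hC_ne_top : (C : ℝ≥0∞) ^ (4 : ℝ)⁻¹ ≠ ∞ :=
    ENNReal.rpow_ne_top_of_nonneg (by norm_num) ENNReal.coe_ne_top
  have hle : eLpNorm (fun e => e a) 3 (Q n h) ≤ (C : ℝ≥0∞) ^ (4 : ℝ)⁻¹ :=
    calc eLpNorm (fun e => e a) 3 (Q n h) ≤ eLpNorm (fun e => e a) 4 (Q n h) :=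
          eLpNorm_le_eLpNorm_of_exponent_le (by norm_num) hcoord
      _ = (∫⁻ e, ‖e a‖ₑ ^ 4 ∂(Q n h)) ^ (4 : ℝ)⁻¹ := by
          simp [eLpNorm_eq_lintegral_rpow_enorm_toReal (p := 4) (by norm_num) (by norm_num)]
      _ ≤ (C : ℝ≥0∞) ^ (4 : ℝ)⁻¹ := by
          gcongr
          refine (lintegral_mono fun e => ?_).trans (hC n h)
          gcongr
          exact enorm_apply_le_enorm_toLp e a
  refine ⟨⟨hcoord, hle.trans_lt hC_ne_top.lt_top⟩, ?_⟩
  rw [← toReal_eLpNorm hcoord]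
  exact ENNReal.toReal_mono hC_ne_top hle

end NoiseMoments

section OneUnit

variable {K : ℕ} {p : Fin K → ℝ}

lemma norm_sum_smul_le_of_mem_stdSimplex {ι E : Type*} [Fintype ι] [SeminormedAddCommGroup E]
    [NormedSpace ℝ E] {p : ι → ℝ} (hp : p ∈ stdSimplex ℝ ι) (f : ι → E) :
    ‖∑ a, p a • f a‖ ≤ ‖f‖ := by
  simpa using (convex_closedBall (0 : E) ‖f‖).sum_mem (fun a _ => hp.1 a) hp.2
    (fun a _ => by simpa using norm_le_pi_norm f a)

lemma integral_armLaw {E : Type*} [NormedAddCommGroup E] [NormedSpace ℝ E] [CompleteSpace E]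
    (hp : ∀ a, 0 ≤ p a) (f : Fin K → E) : ∫ a, f a ∂(armLaw p) = ∑ a, p a • f a := by
  rw [armLaw, integral_finsetSum_measure fun _ _ =>
    Integrable.of_finite.smul_measure ENNReal.ofReal_ne_top]
  simp only [integral_smul_measure, integral_dirac, ENNReal.toReal_ofReal (hp _)]

lemma isProbabilityMeasure_armLaw (hp : p ∈ stdSimplex ℝ (Fin K)) :
    IsProbabilityMeasure (armLaw p) := by
  refine ⟨?_⟩
  simp only [armLaw, Measure.coe_finsetSum, Finset.sum_apply, Measure.smul_apply, measure_univ,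
    smul_eq_mul, mul_one]
  rw [← ENNReal.ofReal_sum_of_nonneg fun a _ => hp.1 a, hp.2, ENNReal.ofReal_one]

/-- The contribution of one unit to the aggregate rewards: the pair of its arm `a` and its vector
of potential rewards `r` is sent to the vector whose only nonzero coordinate is `r a`, at `a`. -/
def pulledReward {K : ℕ} (y : Fin K × (Fin K → ℝ)) : Fin K → ℝ :=
  Pi.single y.1 (y.2 y.1)

lemma measurable_pulledReward : Measurable (pulledReward (K := K)) :=
  measurable_from_prod_countable_right fun a => measurable_pi_lambda _ fun b => by
    obtain rfl | hba := eq_or_ne b a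
    · simpa only [pulledReward, Pi.single_eq_same] using measurable_pi_apply b
    · simpa only [pulledReward, Pi.single_eq_of_ne hba] using measurable_const

lemma strongDual_apply_piSingle {ι : Type*} [DecidableEq ι] (L : StrongDual ℝ (ι → ℝ)) (a : ι)
    (r : ℝ) : L (Pi.single a r) = L (Pi.single a 1) * r := by
  rw [mul_comm, ← smul_eq_mul, ← map_smul, ← Pi.single_smul, smul_eq_mul, mul_one]

lemma charFunDual_map_pulledReward (hp : p ∈ stdSimplex ℝ (Fin K)) (q : Measure (Fin K → ℝ))
    [IsFiniteMeasure q] (L : StrongDual ℝ (Fin K → ℝ)) :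
    charFunDual (((armLaw p).prod q).map pulledReward) L =
      ∑ a, p a • ∫ r, Complex.exp ((L (Pi.single a 1) * r a : ℝ) * Complex.I) ∂q := by
  have := isProbabilityMeasure_armLaw hp
  have hL (y : Fin K × (Fin K → ℝ)) : L (pulledReward y) = L (Pi.single y.1 1) * y.2 y.1 :=
    strongDual_apply_piSingle L y.1 _
  have hmeas : Measurable fun y : Fin K × (Fin K → ℝ) =>
      Complex.exp ((L (pulledReward y) : ℝ) * Complex.I) := by
    have := measurable_pulledReward (K := K)
    fun_prop
  rw [charFunDual_apply, integral_map measurable_pulledReward.aemeasurable (by fun_prop),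
    integral_prod _ (Integrable.of_bound (C := 1) hmeas.aestronglyMeasurable
      (Eventually.of_forall fun y => (Complex.norm_exp_ofReal_mul_I _).le)), integral_armLaw hp.1]
  simp only [hL]

/-- The exponent of the characteristic function, at `u`, of the Gaussian observation of an epoch
with `β n` units, sampling probabilities `p` and average rewards `h`. -/
noncomputable def gaussExponent (β : ℝ) (s u h p : Fin K → ℝ) : ℂ :=
  ∑ a, p a • ((u a * h a : ℝ) * Complex.I - (u a ^ 2 * s a ^ 2 / (2 * β) : ℝ))

lemma re_gaussExponent_nonpos {β : ℝ} (hβ : 0 ≤ β) (s u h : Fin K → ℝ) (hp : ∀ a, 0 ≤ p a) :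
    (gaussExponent β s u h p).re ≤ 0 := by
  simp only [gaussExponent, Complex.re_sum, Complex.smul_re, Complex.sub_re, Complex.re_ofReal_mul,
    Complex.I_re, mul_zero, Complex.ofReal_re, zero_sub, smul_eq_mul]
  exact Finset.sum_nonpos fun a _ =>
    mul_nonpos_of_nonneg_of_nonpos (hp a) (neg_nonpos.2 (by positivity))

lemma continuous_gaussExponent (β : ℝ) (s u : Fin K → ℝ) :
    Continuous fun x : (Fin K → ℝ) × (Fin K → ℝ) => gaussExponent β s u x.1 x.2 := by
  unfold gaussExponent
  fun_prop

lemma charFunDual_pi_gaussianReal {β : ℝ} (hβ : 0 ≤ β) (s h : Fin K → ℝ) (hp : ∀ a, 0 ≤ p a)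
    (L : StrongDual ℝ (Fin K → ℝ)) :
    charFunDual (Measure.pi fun a =>
        gaussianReal (p a * h a) (Real.toNNReal (p a * s a ^ 2 / β))) L =
      Complex.exp (gaussExponent β s (fun a => L (Pi.single a 1)) h p) := by
  rw [charFunDual_pi, gaussExponent, Complex.exp_sum]
  refine Finset.prod_congr rfl fun a _ => ?_
  have hvar : 0 ≤ p a * s a ^ 2 / β := div_nonneg (mul_nonneg (hp a) (sq_nonneg _)) hβ
  have hL : L.comp (.single ℝ (fun _ => ℝ) a) = L (Pi.single a 1) • .id ℝ ℝ := by
    ext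
    simp
  rw [hL, ← charFun_map_eq_charFunDual_smul, ContinuousLinearMap.coe_id', Measure.map_id,
    charFun_gaussianReal, Real.coe_toNNReal _ hvar, Complex.real_smul]
  congr 1
  push_cast
  ring

lemma charFunDual_map_pulledReward_shift {P : Measure (Fin K → ℝ)} [IsFiniteMeasure P]
    (hp : p ∈ stdSimplex ℝ (Fin K)) (L : StrongDual ℝ (Fin K → ℝ)) (c : Fin K → ℝ) (r : ℝ) :
    charFunDual (((armLaw p).prod (P.map fun e a => c a + e a)).map pulledReward) (r • L) =
      ∑ a, p a • ∫ e, Complex.exp ((r * L (Pi.single a 1) * (c a + e a) : ℝ) * Complex.I) ∂P := by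
  have hshift : Measurable fun (e : Fin K → ℝ) a => c a + e a := by fun_prop
  rw [charFunDual_map_pulledReward hp]
  refine Finset.sum_congr rfl fun a _ => ?_
  rw [integral_map hshift.aemeasurable (Measurable.aestronglyMeasurable (by fun_prop))]
  rfl

lemma norm_charFunDual_map_pulledReward_sub_le {P : Measure (Fin K → ℝ)} [IsProbabilityMeasure P]
    {s : Fin K → ℝ} {M : ℝ} (hmean : ∀ a, ∫ e, e a ∂P = 0)
    (hvar : ∀ a, Var[fun e => e a; P] = s a ^ 2) (hP : ∀ a, MemLp (fun e => e a) 3 P)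
    (hM : ∀ a, lpNorm (fun e => e a) 3 P ≤ M) (hp : p ∈ stdSimplex ℝ (Fin K)) {ε β : ℝ}
    (hε0 : 0 ≤ ε) (hε1 : ε ≤ 1) (hβ : β ≠ 0) (L : StrongDual ℝ (Fin K → ℝ)) (h : Fin K → ℝ) :
    ‖charFunDual (((armLaw p).prod (P.map fun e a => ε * h a + e a)).map pulledReward)
          ((ε / β) • L) - 1 -
        (ε ^ 2 / β : ℝ) * gaussExponent β s (fun a => L (Pi.single a 1)) h p‖ ≤
      ε ^ 3 * ‖fun a => |L (Pi.single a 1) / β| ^ 2 * |h a| ^ 2 +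
        4 * |L (Pi.single a 1) / β| ^ 3 * (|h a| + M) ^ 3‖ := by
  let w (a : Fin K) : ℝ := L (Pi.single a 1) / β
  let R (a : Fin K) : ℝ := |w a| ^ 2 * |h a| ^ 2 + 4 * |w a| ^ 3 * (|h a| + M) ^ 3
  let err (a : Fin K) : ℂ :=
    ∫ e, Complex.exp ((ε * w a * (ε * h a + e a) : ℝ) * Complex.I) ∂P - 1 -
      (ε ^ 2 : ℝ) * (w a * h a * Complex.I - w a ^ 2 * s a ^ 2 / 2)
  have hsum : charFunDual (((armLaw p).prod (P.map fun e a => ε * h a + e a)).map pulledReward)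
      ((ε / β) • L) - 1 - (ε ^ 2 / β : ℝ) * gaussExponent β s (fun a => L (Pi.single a 1)) h p =
      ∑ a, p a • err a := by
    have hp1 : (1 : ℂ) = ∑ a, p a • (1 : ℂ) := by rw [← Finset.sum_smul, hp.2, one_smul]
    have hβ' : (β : ℂ) ≠ 0 := by exact_mod_cast hβ
    rw [charFunDual_map_pulledReward_shift hp, gaussExponent, hp1, Finset.mul_sum,
      ← Finset.sum_sub_distrib, ← Finset.sum_sub_distrib]
    refine Finset.sum_congr rfl fun a _ => ?_
    have hw : ε / β * L (Pi.single a 1) = ε * w a := by ring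
    simp only [hw, err, Complex.real_smul]
    generalize ∫ e, Complex.exp ((ε * w a * (ε * h a + e a) : ℝ) * Complex.I) ∂P = φ
    simp only [w]
    push_cast
    field_simp
  have herr (a : Fin K) : ‖err a‖ ≤ ε ^ 3 * ‖R‖ := by
    refine (norm_integral_cexp_scaled_shift_sub_le (hP a) (hmean a) (hvar a) hε0 hε1 _ _).trans ?_
    refine mul_le_mul_of_nonneg_left (le_trans ?_ (le_of_abs_le (norm_le_pi_norm R a)))
      (by positivity)
    have := lpNorm_nonneg (f := fun e : Fin K → ℝ => e a) (p := 3) (μ := P)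
    dsimp only [R]
    gcongr
    exact hM a
  rw [hsum]
  exact (norm_sum_smul_le_of_mem_stdSimplex hp err).trans
    ((pi_norm_le_iff_of_nonneg (by positivity)).2 herr)

lemma norm_pow_floor_sub_cexp_le {φ z : ℂ} (hφ : ‖φ‖ ≤ 1) (hz : z.re ≤ 0) {n : ℕ} (hn : 1 ≤ n)
    {β R B : ℝ} (hβ : 0 < β) (hB : ‖z‖ ≤ B)
    (hR : ‖φ - 1 - ((√(n : ℝ))⁻¹ ^ 2 / β : ℝ) * z‖ ≤ (√(n : ℝ))⁻¹ ^ 3 * R) :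
    ‖φ ^ ⌊β * n⌋₊ - Complex.exp z‖ ≤ (√(n : ℝ))⁻¹ * (β * R + 3 / β * B ^ 2 + 2 / β * B) := by
  set ε : ℝ := (√(n : ℝ))⁻¹ with hε
  set m : ℕ := ⌊β * n⌋₊
  set δ : ℝ := ε ^ 2 / β with hδ
  have hn' : (1 : ℝ) ≤ n := by exact_mod_cast hn
  have hε0 : 0 < ε := by positivity
  have hε1 : ε ≤ 1 := inv_le_one_of_one_le₀ (Real.one_le_sqrt.2 hn')
  have hδ0 : 0 ≤ δ := by positivity
  have hβnδ : β * n * δ = 1 := by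
    rw [hδ, hε, inv_pow, Real.sq_sqrt (by positivity)]
    field_simp
  have hmδ : m * δ ≤ 1 := by
    rw [← hβnδ]
    gcongr
    exact Nat.floor_le (by positivity)
  have hmδ' : 1 ≤ m * δ + δ := by
    rw [← hβnδ, ← add_one_mul]
    gcongr
    exact (Nat.lt_floor_add_one _).le
  have hδε : δ ≤ ε / β := by
    rw [hδ]
    gcongr
    nlinarith
  have hB0 : 0 ≤ B := (norm_nonneg z).trans hB
  have hR0 : 0 ≤ R := nonneg_of_mul_nonneg_right ((norm_nonneg _).trans hR) (by positivity)
  calc ‖φ ^ m - Complex.exp z‖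
      ≤ m * (‖φ - 1 - δ * z‖ + 3 * δ ^ 2 * ‖z‖ ^ 2) + 2 * δ * ‖z‖ :=
        norm_pow_sub_cexp_le hφ hz hδ0 hmδ hmδ'
    _ ≤ m * (ε ^ 3 * R + 3 * δ ^ 2 * B ^ 2) + 2 * δ * B := by gcongr
    _ = m * δ * (β * ε * R + 3 * δ * B ^ 2) + 2 * δ * B := by
        have hε3 : ε ^ 3 = δ * (β * ε) := by
          rw [hδ]
          field_simp
        rw [hε3]
        ring
    _ ≤ 1 * (β * ε * R + 3 * (ε / β) * B ^ 2) + 2 * (ε / β) * B := by gcongr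
    _ = ε * (β * R + 3 / β * B ^ 2 + 2 / β * B) := by ring

lemma isProbabilityMeasure_map_pulledReward (hp : p ∈ stdSimplex ℝ (Fin K))
    {P : Measure (Fin K → ℝ)} [IsProbabilityMeasure P] (c : Fin K → ℝ) :
    IsProbabilityMeasure (((armLaw p).prod (P.map fun e a => c a + e a)).map pulledReward) := by
  have := isProbabilityMeasure_armLaw hp
  have hshift : Measurable fun (e : Fin K → ℝ) a => c a + e a := by fun_prop
  have := Measure.isProbabilityMeasure_map (μ := P) hshift.aemeasurable
  exact Measure.isProbabilityMeasure_map measurable_pulledReward.aemeasurable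

lemma IsNoiseModel.exists_norm_charFunDual_pow_sub_cexp_le {s : Fin K → ℝ}
    {Q : ℕ → (Fin K → ℝ) → Measure (Fin K → ℝ)} (hQ : IsNoiseModel s Q) {β : ℝ} (hβ : 0 < β)
    (L : StrongDual ℝ (Fin K → ℝ)) :
    ∃ S : (Fin K → ℝ) → ℝ, Measurable S ∧ ∀ n : ℕ, 1 ≤ n → ∀ h, ∀ p ∈ stdSimplex ℝ (Fin K),
      ‖charFunDual (((armLaw p).prod ((Q n h).map fun e a => h a / √(n : ℝ) + e a)).map
            pulledReward) ((1 / (β * √(n : ℝ))) • L) ^ ⌊β * n⌋₊ -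
          Complex.exp (gaussExponent β s (fun a => L (Pi.single a 1)) h p)‖ ≤
        (√(n : ℝ))⁻¹ * S h := by
  obtain ⟨M, hM⟩ := hQ.exists_lpNorm_le
  let u (a : Fin K) : ℝ := L (Pi.single a 1)
  let R (h : Fin K → ℝ) : ℝ :=
    ‖fun a => |u a / β| ^ 2 * |h a| ^ 2 + 4 * |u a / β| ^ 3 * (|h a| + M) ^ 3‖
  let B (h : Fin K → ℝ) : ℝ :=
    ‖fun a => ((u a * h a : ℝ) * Complex.I - (u a ^ 2 * s a ^ 2 / (2 * β) : ℝ) : ℂ)‖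
  refine ⟨fun h => β * R h + 3 / β * B h ^ 2 + 2 / β * B h, by fun_prop, fun n hn h p hp => ?_⟩
  have := hQ.isProbabilityMeasure n h
  have := isProbabilityMeasure_map_pulledReward hp (P := Q n h) fun a => h a / √(n : ℝ)
  refine norm_pow_floor_sub_cexp_le (norm_charFunDual_le_one _ _)
    (re_gaussExponent_nonpos hβ.le s u h hp.1) hn hβ
    (norm_sum_smul_le_of_mem_stdSimplex hp _) ?_
  have hε1 : (√(n : ℝ))⁻¹ ≤ 1 :=
    inv_le_one_of_one_le₀ (Real.one_le_sqrt.2 (by exact_mod_cast hn))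
  have hscale : 1 / (β * √(n : ℝ)) = (√(n : ℝ))⁻¹ / β := by
    rw [one_div, mul_inv_rev, div_eq_mul_inv]
  simp only [hscale, div_eq_inv_mul _ √(n : ℝ)]
  exact norm_charFunDual_map_pulledReward_sub_le (hQ.mean_eq_zero n h) (hQ.variance_eq n h)
    (fun a => (hM n h a).1) (fun a => (hM n h a).2) hp (by positivity) hε1 hβ.ne' L h

end OneUnit

section Epoch

lemma charFunDual_map_smul_sum_pi {ι α E : Type*} [Fintype ι] [MeasurableSpace α]
    [NormedAddCommGroup E] [NormedSpace ℝ E] [MeasurableSpace E] [BorelSpace E]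
    [SecondCountableTopology E] (ρ : Measure α) [IsProbabilityMeasure ρ] {f : α → E}
    (hf : Measurable f) (c : ℝ) (L : StrongDual ℝ E) :
    charFunDual ((Measure.pi fun _ : ι => ρ).map fun y => c • ∑ j, f (y j)) L =
      charFunDual (ρ.map f) (c • L) ^ Fintype.card ι := by
  have := Measure.isProbabilityMeasure_map (μ := ρ) hf.aemeasurable
  have hsum : Measurable fun y : ι → E => ∑ j, y j := by fun_prop
  have hfun : Measurable fun (y : ι → α) j => f (y j) := by fun_prop
  have hmap : ((Measure.pi fun _ : ι => ρ).map fun y => c • ∑ j, f (y j)) =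
      ((Measure.pi fun _ : ι => ρ.map f).map fun y => ∑ j, y j).map
        (c • ContinuousLinearMap.id ℝ E) := by
    rw [← Measure.pi_map_pi fun _ => hf.aemeasurable, Measure.map_map hsum hfun,
      Measure.map_map (by fun_prop) (hsum.comp hfun)]
    rfl
  rw [hmap, charFunDual_map, charFunDual_map_sum_pi_eq_prod, Finset.prod_apply]
  simp [Finset.card_univ]

lemma tendsto_integral_min_abs_mul {ι α : Type*} [MeasurableSpace α] {l : Filter ι}
    [l.IsCountablyGenerated] (ρ : Measure α) [IsFiniteMeasure ρ] {ε : ι → ℝ}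
    (hε : Tendsto ε l (𝓝 0)) {S : α → ℝ} (hS : Measurable S) {c : ℝ} (hc : 0 ≤ c) :
    Tendsto (fun i => ∫ x, min c |ε i * S x| ∂ρ) l (𝓝 0) := by
  have hlim (x : α) : Tendsto (fun i => min c |ε i * S x|) l (𝓝 0) := by
    simpa [hc] using (tendsto_const_nhds (x := c)).min (hε.mul_const (S x)).abs
  simpa using tendsto_integral_filter_of_dominated_convergence (fun _ => c)
    (Eventually.of_forall fun i => Measurable.aestronglyMeasurable (by fun_prop))
    (Eventually.of_forall fun i => Eventually.of_forall fun x => by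
      rw [Real.norm_of_nonneg (le_min hc (abs_nonneg _))]
      exact min_le_left _ _)
    (integrable_const c) (Eventually.of_forall hlim)

variable {K : ℕ}

/-- The limiting conditional characteristic function, at `L`, of the observation of epoch `t`, as a
function of the past. -/
noncomputable def epochCharFun (π : AdaptivePolicy K) (β : ℝ) (s : Fin K → ℝ) (t : ℕ)
    (L : StrongDual ℝ (Fin K → ℝ)) (x : (Fin K → ℝ) × (Fin t → Fin K → ℝ)) : ℂ :=
  Complex.exp (gaussExponent β s (fun a => L (Pi.single a 1)) x.1 (π.prob t x.2))

variable (π : AdaptivePolicy K) {β : ℝ} (s : Fin K → ℝ) (t : ℕ) (L : StrongDual ℝ (Fin K → ℝ))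

lemma measurable_epochCharFun : Measurable (epochCharFun π β s t L) := by
  have := π.measurable_prob t
  have := (continuous_gaussExponent β s fun a => L (Pi.single a 1)).measurable
  unfold epochCharFun
  fun_prop

lemma norm_epochCharFun_le_one (hβ : 0 ≤ β) (x : (Fin K → ℝ) × (Fin t → Fin K → ℝ)) :
    ‖epochCharFun π β s t L x‖ ≤ 1 :=
  norm_cexp_le_one_of_re_nonpos (re_gaussExponent_nonpos hβ s _ x.1 (π.prob_mem t x.2).1)

lemma continuousAt_epochCharFun {x : (Fin K → ℝ) × (Fin t → Fin K → ℝ)}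
    (hx : ContinuousAt (π.prob t) x.2) : ContinuousAt (epochCharFun π β s t L) x :=
  Complex.continuous_exp.continuousAt.comp <|
    (continuous_gaussExponent β s fun a => L (Pi.single a 1)).continuousAt.comp
      (f := fun x : (Fin K → ℝ) × (Fin t → Fin K → ℝ) => (x.1, π.prob t x.2))
      (continuousAt_fst.prodMk (hx.comp continuousAt_snd))

end Epoch

section Past

lemma past_zero {K T : ℕ} {Ω : Type*} (h : Ω → Fin K → ℝ) (obs : Fin T → Ω → Fin K → ℝ) :
    past h obs 0 T.zero_le = fun ω => (h ω, finZeroElim) :=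
  funext fun _ => Prod.ext rfl (Subsingleton.elim _ _)

lemma past_succ {K T : ℕ} {Ω : Type*} {t : ℕ} (h : Ω → Fin K → ℝ)
    (obs : Fin T → Ω → Fin K → ℝ) (ht : t + 1 ≤ T) :
    past h obs (t + 1) ht = fun ω =>
      ((past h obs t (Nat.le_of_succ_le ht) ω).1, Fin.snoc (α := fun _ => Fin K → ℝ)
        (past h obs t (Nat.le_of_succ_le ht) ω).2 (obs ⟨t, ht⟩ ω)) := by
  refine funext fun ω => Prod.ext rfl (funext fun i => ?_)
  dsimp only
  induction i using Fin.lastCases with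
  | last =>
    rw [Fin.snoc_last]
    rfl
  | cast j =>
    rw [Fin.snoc_castSucc]
    rfl

variable {K T : ℕ} {Ω : Type*} [MeasurableSpace Ω] {P : Measure Ω} {h : Ω → Fin K → ℝ}
  {obs : Fin T → Ω → Fin K → ℝ} {t : ℕ}

lemma measurable_past (hh : Measurable h) (hobs : ∀ t, Measurable (obs t)) (ht : t ≤ T) :
    Measurable (past h obs t ht) :=
  hh.prodMk (measurable_pi_lambda _ fun i => hobs (Fin.castLE ht i))

lemma ae_continuousAt_prob (π : AdaptivePolicy K) (hh : Measurable h)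
    (hobs : ∀ t, Measurable (obs t)) (ht : t ≤ T)
    (hπ : P.map (history obs t ht) {r | ¬ ContinuousAt (π.prob t) r} = 0) :
    ∀ᵐ x ∂(P.map (past h obs t ht)), ContinuousAt (π.prob t) x.2 := by
  have hmap : P.map (history obs t ht) = (P.map (past h obs t ht)).map Prod.snd := by
    rw [Measure.map_map measurable_snd (measurable_past hh hobs ht)]
    rfl
  rw [hmap] at hπ
  exact ae_of_ae_map measurable_snd.aemeasurable (ae_iff.2 hπ)

variable {Ω₁ : Type*} [MeasurableSpace Ω₁] {P₁ : Measure Ω₁} {h₁ : Ω₁ → Fin K → ℝ}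
  {obs₁ : Fin T → Ω₁ → Fin K → ℝ}

lemma identDistrib_past_zero (hident : IdentDistrib h₁ h P₁ P) :
    IdentDistrib (past h₁ obs₁ 0 T.zero_le) (past h obs 0 T.zero_le) P₁ P := by
  simpa only [past_zero, Function.comp_def] using
    hident.comp (u := fun x => (x, (finZeroElim : Fin 0 → Fin K → ℝ))) (by fun_prop)

lemma identDistrib_fst_map_past (hident : IdentDistrib h₁ h P₁ P) (hh₁ : Measurable h₁)
    (hobs₁ : ∀ t, Measurable (obs₁ t)) (hh : Measurable h) (hobs : ∀ t, Measurable (obs t))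
    (ht : t ≤ T) :
    IdentDistrib Prod.fst Prod.fst (P₁.map (past h₁ obs₁ t ht)) (P.map (past h obs t ht)) := by
  refine ⟨measurable_fst.aemeasurable, measurable_fst.aemeasurable, ?_⟩
  rw [Measure.map_map measurable_fst (measurable_past hh₁ hobs₁ ht),
    Measure.map_map measurable_fst (measurable_past hh hobs ht)]
  exact hident.map_eq

end Past

lemma measurable_smul_sum_pulledReward {ι : Type*} [Fintype ι] {K : ℕ} (c : ℝ) :
    Measurable fun y : ι → Fin K × (Fin K → ℝ) => c • ∑ j, pulledReward (y j) := by
  have := measurable_pulledReward (K := K)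
  fun_prop

lemma BatchedData.scaledMean_eq_comp {K T : ℕ} {b : Fin T → ℝ} {n : ℕ} {Ω : Type*}
    (D : BatchedData K T b n Ω) (t : Fin T) :
    D.scaledMean t = (fun y => (1 / (b t * √(n : ℝ))) • ∑ j, pulledReward (y j)) ∘
      fun ω j => (D.arm t j ω, D.reward t j ω) := by
  ext ω a
  simp only [BatchedData.scaledMean, Function.comp_apply, Pi.smul_apply, Finset.sum_apply,
    smul_eq_mul, pulledReward, Pi.single_apply, ite_mul, one_mul, zero_mul]
  congr! 2 with j
  grind

namespace IsBatchedExperiment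

variable {K T : ℕ} [NeZero K] {b : Fin T → ℝ} {n : ℕ} {Ω : Type*} [MeasurableSpace Ω]
  {P : Measure Ω} [IsProbabilityMeasure P] {ν : Measure (Fin K → ℝ)} {π : AdaptivePolicy K}
  {Q : ℕ → (Fin K → ℝ) → Measure (Fin K → ℝ)} {D : BatchedData K T b n Ω}

lemma identDistrib_h {n' : ℕ} {Ω' : Type*} [MeasurableSpace Ω'] {P' : Measure Ω'}
    [IsProbabilityMeasure P'] {D' : BatchedData K T b n' Ω'} (hD : IsBatchedExperiment P ν π Q D)
    (hD' : IsBatchedExperiment P' ν π Q D') : IdentDistrib D.h D'.h P P' :=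
  ⟨hD.measurable_h.aemeasurable, hD'.measurable_h.aemeasurable, hD.map_h.trans hD'.map_h.symm⟩

lemma identDistrib_h_gaussian {s : Fin K → ℝ} {Ω' : Type*} [MeasurableSpace Ω']
    {P' : Measure Ω'} [IsProbabilityMeasure P'] {E : GaussianData K T Ω'}
    (hD : IsBatchedExperiment P ν π Q D) (hE : IsGaussianExperiment P' b s ν π E) :
    IdentDistrib D.h E.h P P' :=
  ⟨hD.measurable_h.aemeasurable, hE.measurable_h.aemeasurable, hD.map_h.trans hE.map_h.symm⟩

lemma measurable_units (hD : IsBatchedExperiment P ν π Q D) (t : Fin T) :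
    Measurable fun ω j => (D.arm t j ω, D.reward t j ω) :=
  measurable_pi_lambda _ fun j => (hD.measurable_arm t j).prodMk (hD.measurable_reward t j)

lemma measurable_scaledMean (hD : IsBatchedExperiment P ν π Q D) (t : Fin T) :
    Measurable (D.scaledMean t) := by
  rw [D.scaledMean_eq_comp t]
  exact (measurable_smul_sum_pulledReward _).comp (hD.measurable_units t)

lemma condDistrib_units (hD : IsBatchedExperiment P ν π Q D) (t : Fin T) :
    ∀ᵐ x ∂(P.map (past D.h D.scaledMean t t.isLt.le)),
      condDistrib (fun ω j => (D.arm t j ω, D.reward t j ω))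
          (past D.h D.scaledMean t t.isLt.le) P x =
        Measure.pi fun _ => (armLaw (π.prob t x.2)).prod
          ((Q n x.1).map fun e a => x.1 a / √(n : ℝ) + e a) := by
  filter_upwards [hD.units_indep t, ae_all_iff.2 (hD.ignorability t), ae_all_iff.2 (hD.arm_law t),
    ae_all_iff.2 (hD.reward_law t)] with x hindep hign harm hreward
  rw [hindep]
  congr! with j
  rw [hign, harm, hreward]

lemma charFunDual_condDistrib_scaledMean (hD : IsBatchedExperiment P ν π Q D)
    (hQ : ∀ h, IsProbabilityMeasure (Q n h)) (t : Fin T) (L : StrongDual ℝ (Fin K → ℝ)) :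
    ∀ᵐ x ∂(P.map (past D.h D.scaledMean t t.isLt.le)),
      charFunDual (condDistrib (D.scaledMean t) (past D.h D.scaledMean t t.isLt.le) P x) L =
        charFunDual (((armLaw (π.prob t x.2)).prod
            ((Q n x.1).map fun e a => x.1 a / √(n : ℝ) + e a)).map pulledReward)
          ((1 / (b t * √(n : ℝ))) • L) ^ ⌊b t * n⌋₊ := by
  have hcomp := condDistrib_comp (mβ := inferInstance) (μ := P)
    (past D.h D.scaledMean t t.isLt.le) (hD.measurable_units t).aemeasurable
    (measurable_smul_sum_pulledReward (1 / (b t * √(n : ℝ))))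
  rw [← D.scaledMean_eq_comp t] at hcomp
  filter_upwards [hcomp, hD.condDistrib_units t] with x hx hunits
  have := hQ x.1
  have := isProbabilityMeasure_armLaw (π.prob_mem t x.2)
  have hshift : Measurable fun (e : Fin K → ℝ) a => x.1 a / √(n : ℝ) + e a := by fun_prop
  have := Measure.isProbabilityMeasure_map (μ := Q n x.1) hshift.aemeasurable
  rw [hx, Kernel.map_apply _ (measurable_smul_sum_pulledReward _), hunits,
    charFunDual_map_smul_sum_pi _ measurable_pulledReward, Fintype.card_fin, batchSize]

lemma integral_norm_charFunDual_condDistrib_scaledMean_sub_le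
    (hD : IsBatchedExperiment P ν π Q D) (hQ : ∀ h, IsProbabilityMeasure (Q n h)) (t : Fin T)
    (hb : 0 ≤ b t) (s : Fin K → ℝ) (L : StrongDual ℝ (Fin K → ℝ)) {S : (Fin K → ℝ) → ℝ}
    (hS : Measurable S)
    (hle : ∀ h, ∀ p ∈ stdSimplex ℝ (Fin K),
      ‖charFunDual (((armLaw p).prod ((Q n h).map fun e a => h a / √(n : ℝ) + e a)).map
            pulledReward) ((1 / (b t * √(n : ℝ))) • L) ^ ⌊b t * n⌋₊ -
          Complex.exp (gaussExponent (b t) s (fun a => L (Pi.single a 1)) h p)‖ ≤ S h) :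
    ∫ x, ‖charFunDual (condDistrib (D.scaledMean t) (past D.h D.scaledMean t t.isLt.le) P x) L -
        epochCharFun π (b t) s t L x‖ ∂(P.map (past D.h D.scaledMean t t.isLt.le)) ≤
      ∫ h, min 2 |S h| ∂ν := by
  have hX := measurable_past hD.measurable_h hD.measurable_scaledMean t.isLt.le
  have hν : ν = (P.map (past D.h D.scaledMean t t.isLt.le)).map Prod.fst := by
    rw [Measure.map_map measurable_fst hX, ← hD.map_h]
    rfl
  have := Measure.isProbabilityMeasure_map (μ := P) hX.aemeasurable
  have hmin_le (x : Fin K → ℝ) : ‖min 2 |S x|‖ ≤ 2 := by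
    rw [Real.norm_of_nonneg (le_min zero_le_two (abs_nonneg _))]
    exact min_le_left _ _
  rw [hν, integral_map measurable_fst.aemeasurable
    (Measurable.aestronglyMeasurable (by fun_prop))]
  refine integral_mono_of_nonneg (Eventually.of_forall fun x => norm_nonneg _)
    (Integrable.of_bound (Measurable.aestronglyMeasurable (by fun_prop)) 2
      (Eventually.of_forall fun x => hmin_le x.1)) ?_
  filter_upwards [hD.charFunDual_condDistrib_scaledMean hQ t L] with x hx
  refine le_min ?_ ?_
  · refine (norm_sub_le _ _).trans ?_
    linarith [norm_charFunDual_le_one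
      (condDistrib (D.scaledMean t) (past D.h D.scaledMean t t.isLt.le) P x) L,
      norm_epochCharFun_le_one π s t L hb x]
  · rw [hx]
    exact (hle x.1 _ (π.prob_mem t x.2)).trans (le_abs_self _)

end IsBatchedExperiment

lemma IsGaussianExperiment.charFunDual_condDistrib_G {K T : ℕ} [NeZero K] {b : Fin T → ℝ}
    {s : Fin K → ℝ} {Ω : Type*} [MeasurableSpace Ω] {P : Measure Ω} [IsProbabilityMeasure P]
    {ν : Measure (Fin K → ℝ)} {π : AdaptivePolicy K} {E : GaussianData K T Ω}
    (hE : IsGaussianExperiment P b s ν π E) (t : Fin T) (hb : 0 ≤ b t)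
    (L : StrongDual ℝ (Fin K → ℝ)) :
    ∀ᵐ x ∂(P.map (past E.h E.G t t.isLt.le)),
      charFunDual (condDistrib (E.G t) (past E.h E.G t t.isLt.le) P x) L =
        epochCharFun π (b t) s t L x := by
  filter_upwards [hE.G_law t] with x hx
  rw [hx, charFunDual_pi_gaussianReal hb s x.1 (π.prob_mem t x.2).1, epochCharFun]

section Limit

variable {K T : ℕ} [NeZero K] {b : Fin T → ℝ} {s : Fin K → ℝ} {ν : Measure (Fin K → ℝ)}
  {π : AdaptivePolicy K} {Q : ℕ → (Fin K → ℝ) → Measure (Fin K → ℝ)}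
  {Ω : ℕ → Type*} [∀ n, MeasurableSpace (Ω n)] {P : (n : ℕ) → Measure (Ω n)}
  [∀ n, IsProbabilityMeasure (P n)] {D : (n : ℕ) → BatchedData K T b n (Ω n)}
  {Ω' : Type*} [MeasurableSpace Ω'] {P' : Measure Ω'} [IsProbabilityMeasure P']
  {E : GaussianData K T Ω'}

lemma tendsto_integral_norm_charFunDual_condDistrib_scaledMean_sub [IsFiniteMeasure ν]
    (hQ : IsNoiseModel s Q) (hD : ∀ n, IsBatchedExperiment (P n) ν π Q (D n)) (t : Fin T)
    (hb : 0 < b t) (L : StrongDual ℝ (Fin K → ℝ)) :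
    Tendsto (fun n => ∫ x, ‖charFunDual (condDistrib ((D n).scaledMean t)
          (past (D n).h (D n).scaledMean t t.isLt.le) (P n) x) L - epochCharFun π (b t) s t L x‖
        ∂((P n).map (past (D n).h (D n).scaledMean t t.isLt.le))) atTop (𝓝 0) := by
  obtain ⟨S, hS, hle⟩ := hQ.exists_norm_charFunDual_pow_sub_cexp_le hb L
  have hε : Tendsto (fun n : ℕ => (√(n : ℝ))⁻¹) atTop (𝓝 0) :=
    (Real.tendsto_sqrt_atTop.comp tendsto_natCast_atTop_atTop).inv_tendsto_atTop
  refine squeeze_zero' (Eventually.of_forall fun n => integral_nonneg fun x => norm_nonneg _) ?_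
    (tendsto_integral_min_abs_mul ν hε hS zero_le_two)
  filter_upwards [eventually_ge_atTop 1] with n hn
  exact (hD n).integral_norm_charFunDual_condDistrib_scaledMean_sub_le
    (hQ.isProbabilityMeasure n) t hb.le s L (hS.const_mul _) (hle n hn)

lemma tendstoInDistribution_past [IsFiniteMeasure ν] (hb : ∀ t, 0 < b t) (hQ : IsNoiseModel s Q)
    (hD : ∀ n, IsBatchedExperiment (P n) ν π Q (D n)) (hE : IsGaussianExperiment P' b s ν π E)
    {t : ℕ} (ht : t ≤ T)
    (hπ : ∀ t' (ht' : t' < t), P'.map (history E.G t' (ht'.le.trans ht))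
      {r | ¬ ContinuousAt (π.prob t') r} = 0) :
    TendstoInDistribution (fun n => past (D n).h (D n).scaledMean t ht) atTop (past E.h E.G t ht)
      P P' := by
  induction t with
  | zero =>
    exact tendstoInDistribution_of_identDistrib 0
      (fun n => identDistrib_past_zero ((hD 0).identDistrib_h (hD n)))
      (identDistrib_past_zero ((hD 0).identDistrib_h_gaussian hE))
  | succ t ih =>
    have hpast := ih (Nat.le_of_succ_le ht) fun t' ht' => hπ t' (ht'.trans t.lt_succ_self)
    have hcont := ae_continuousAt_prob π hE.measurable_h hE.measurable_G (Nat.le_of_succ_le ht)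
      (hπ t t.lt_succ_self)
    have hpair := tendstoInDistribution_prodMk_of_charFunDual_condDistrib hpast
      (fun n => ((hD n).measurable_scaledMean ⟨t, ht⟩).aemeasurable)
      (hE.measurable_G ⟨t, ht⟩).aemeasurable
      (fun L => measurable_epochCharFun π s t L)
      (fun L => norm_epochCharFun_le_one π s t L (hb ⟨t, ht⟩).le)
      (fun L => hcont.mono fun x hx => continuousAt_epochCharFun π s t L hx)
      (fun L => tendsto_integral_norm_charFunDual_condDistrib_scaledMean_sub hQ hD ⟨t, ht⟩
        (hb _) L)
      (fun L => hE.charFunDual_condDistrib_G ⟨t, ht⟩ (hb _).le L)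
    have hsnoc : Continuous fun y : ((Fin K → ℝ) × (Fin t → Fin K → ℝ)) × (Fin K → ℝ) =>
        (y.1.1, Fin.snoc (α := fun _ => Fin K → ℝ) y.1.2 y.2) :=
      (continuous_fst.comp continuous_fst).prodMk <|
        (continuous_snd.comp continuous_fst).finSnoc (A := fun _ => Fin K → ℝ) continuous_snd
    simpa only [past_succ, Function.comp_def] using hpair.continuous_comp hsnoc

end Limit

section Regret

lemma integrable_id_of_integrable_sum_abs {ι : Type*} [Fintype ι] {ν : Measure (ι → ℝ)}
    (hν : Integrable (fun h : ι → ℝ => ∑ a, |h a|) ν) : Integrable id ν := by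
  refine hν.mono' aestronglyMeasurable_id (Eventually.of_forall fun h => ?_)
  refine (pi_norm_le_iff_of_nonneg (by positivity)).2 fun a => ?_
  exact Finset.single_le_sum (f := fun a => |h a|) (fun _ _ => abs_nonneg _) (Finset.mem_univ a)

variable {K T : ℕ} [NeZero K]

/-- The expected simple regret of the final selection of an experiment with `T` epochs, given the
average rewards and all the observations. -/
noncomputable def selectionRegret (π : AdaptivePolicy K) (T : ℕ)
    (x : (Fin K → ℝ) × (Fin T → Fin K → ℝ)) : ℝ :=
  ∑ a, π.prob T x.2 a • ((⨆ a', x.1 a') - x.1 a)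

lemma continuous_iSup_apply : Continuous fun h : Fin K → ℝ => ⨆ a, h a := by
  simp only [← Finset.sup'_univ_eq_ciSup]
  exact Continuous.finset_sup'_apply _ fun a _ => continuous_apply a

lemma norm_iSup_sub_apply_le (h : Fin K → ℝ) : ‖fun a => (⨆ a', h a') - h a‖ ≤ 2 * ‖h‖ := by
  have happly (a : Fin K) : |h a| ≤ ‖h‖ := norm_le_pi_norm h a
  have hsup : ⨆ a, h a ≤ ‖h‖ := ciSup_le fun a => (le_abs_self _).trans (happly a)
  refine (pi_norm_le_iff_of_nonneg (by positivity)).2 fun a => ?_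
  have hle : h a ≤ ⨆ a', h a' := le_ciSup (Set.finite_range h).bddAbove a
  rw [Real.norm_eq_abs, abs_of_nonneg (sub_nonneg.2 hle)]
  linarith [neg_le_of_abs_le (happly a)]

lemma measurable_selectionRegret (π : AdaptivePolicy K) : Measurable (selectionRegret π T) := by
  have := π.measurable_prob T
  have := (continuous_iSup_apply (K := K)).measurable
  unfold selectionRegret
  fun_prop

lemma continuousAt_selectionRegret {π : AdaptivePolicy K}
    {x : (Fin K → ℝ) × (Fin T → Fin K → ℝ)} (hx : ContinuousAt (π.prob T) x.2) :
    ContinuousAt (selectionRegret π T) x := by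
  have hsup := (continuous_iSup_apply (K := K)).continuousAt.comp (continuousAt_fst (p := x))
  refine tendsto_finsetSum _ fun a _ => ?_
  exact (((continuous_apply a).continuousAt.comp hx).comp continuousAt_snd).smul
    (hsup.sub ((continuous_apply a).continuousAt.comp continuousAt_fst))

lemma abs_selectionRegret_le (π : AdaptivePolicy K) (x : (Fin K → ℝ) × (Fin T → Fin K → ℝ)) :
    |selectionRegret π T x| ≤ 2 * ‖x.1‖ :=
  (norm_sum_smul_le_of_mem_stdSimplex (π.prob_mem T x.2) _).trans (norm_iSup_sub_apply_le x.1)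

variable {Ω : Type*} [MeasurableSpace Ω] {P : Measure Ω} [IsFiniteMeasure P]
  {h : Ω → Fin K → ℝ} {obs : Fin T → Ω → Fin K → ℝ} {choice : Ω → Fin K} {π : AdaptivePolicy K}

lemma bayesSimpleRegret_eq_integral_selectionRegret (hh : Measurable h)
    (hobs : ∀ t, Measurable (obs t)) (hchoice : Measurable choice)
    (hsel : IsFinalSelection P π h obs choice) (hint : Integrable h P) :
    bayesSimpleRegret P h choice =
      ∫ x, selectionRegret π T x ∂(P.map (past h obs T le_rfl)) := by
  have hX := measurable_past hh hobs le_rfl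
  have hpair := compProd_map_condDistrib (mβ := inferInstance) (μ := P)
    (X := past h obs T le_rfl) hchoice.aemeasurable
  have hXc := hX.prodMk hchoice
  let regret (y : ((Fin K → ℝ) × (Fin T → Fin K → ℝ)) × Fin K) : ℝ := (⨆ a, y.1.1 a) - y.1.1 y.2
  have hregret : Measurable regret := by
    have heval : Measurable fun y : (Fin K → ℝ) × Fin K => y.1 y.2 :=
      measurable_from_prod_countable_left fun a => measurable_pi_apply a
    have hfst : Measurable fun y : ((Fin K → ℝ) × (Fin T → Fin K → ℝ)) × Fin K => y.1.1 := by
      fun_prop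
    exact (continuous_iSup_apply.measurable.comp hfst).sub (heval.comp (hfst.prodMk measurable_snd))
  have hregret_int : Integrable regret (P.map fun ω => (past h obs T le_rfl ω, choice ω)) := by
    refine (integrable_map_measure hregret.aestronglyMeasurable hXc.aemeasurable).2 ?_
    refine (hint.norm.const_mul 2).mono' (hregret.comp hXc).aestronglyMeasurable ?_
    exact Eventually.of_forall fun ω =>
      (norm_le_pi_norm _ (choice ω)).trans (norm_iSup_sub_apply_le (h ω))
  calc bayesSimpleRegret P h choice
      = ∫ y, regret y ∂(P.map fun ω => (past h obs T le_rfl ω, choice ω)) :=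
        (integral_map hXc.aemeasurable hregret.aestronglyMeasurable).symm
    _ = ∫ x, ∫ a, regret (x, a) ∂(condDistrib choice (past h obs T le_rfl) P x)
          ∂(P.map (past h obs T le_rfl)) := by
        rw [← hpair] at hregret_int ⊢
        exact Measure.integral_compProd hregret_int
    _ = ∫ x, selectionRegret π T x ∂(P.map (past h obs T le_rfl)) := by
        refine integral_congr_ae ?_
        filter_upwards [hsel] with x hx
        rw [hx, integral_armLaw (π.prob_mem T x.2).1, selectionRegret]

end Regret

theorem mainTheorem6 {K T : ℕ} [NeZero K] (b : Fin T → ℝ) (hb : ∀ t, 0 < b t) (s : Fin K → ℝ)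
    (ν : Measure (Fin K → ℝ)) [IsProbabilityMeasure ν]
    (hν : Integrable (fun h : Fin K → ℝ => ∑ a, |h a|) ν)
    (π : AdaptivePolicy K)
    (Q : ℕ → (Fin K → ℝ) → Measure (Fin K → ℝ)) (hQ : IsNoiseModel s Q)
    {Ω : ℕ → Type*} [∀ n, MeasurableSpace (Ω n)] (P : (n : ℕ) → Measure (Ω n))
    [∀ n, IsProbabilityMeasure (P n)] (D : (n : ℕ) → BatchedData K T b n (Ω n))
    (hD : ∀ n, IsBatchedExperiment (P n) ν π Q (D n))
    {Ω' : Type*} [MeasurableSpace Ω'] (P' : Measure Ω') [IsProbabilityMeasure P']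
    (E : GaussianData K T Ω') (hE : IsGaussianExperiment P' b s ν π E)
    (hπ : ∀ (t : ℕ) (ht : t ≤ T),
      P'.map (history E.G t ht) {r | ¬ ContinuousAt (π.prob t) r} = 0) :
    Tendsto (fun n => bayesSimpleRegret (P n) (D n).h (D n).choice) atTop
      (𝓝 (bayesSimpleRegret P' E.h E.choice)) := by
  have hν_int := integrable_id_of_integrable_sum_abs hν
  have hDh_int (n : ℕ) : Integrable (D n).h (P n) :=
    ((hD n).map_h ▸ hν_int).comp_measurable (hD n).measurable_h
  have hEh_int : Integrable E.h P' := (hE.map_h ▸ hν_int).comp_measurable hE.measurable_h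
  have hpast := tendstoInDistribution_past hb hQ hD hE le_rfl fun t ht => hπ t ht.le
  have hcont := ae_continuousAt_prob π hE.measurable_h hE.measurable_G le_rfl (hπ T le_rfl)
  have hfst (n : ℕ) := identDistrib_fst_map_past ((hD n).identDistrib_h_gaussian hE)
    (hD n).measurable_h (hD n).measurable_scaledMean hE.measurable_h hE.measurable_G le_rfl
  simp only [bayesSimpleRegret_eq_integral_selectionRegret hE.measurable_h hE.measurable_G
      hE.measurable_choice hE.choice_law hEh_int, fun n =>
    bayesSimpleRegret_eq_integral_selectionRegret (hD n).measurable_h (hD n).measurable_scaledMean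
      (hD n).measurable_choice (hD n).choice_law (hDh_int n)]
  refine tendsto_integral_of_ae_continuousAt_of_identDistrib hpast.tendsto
    (measurable_selectionRegret π) (hcont.mono fun x hx => continuousAt_selectionRegret hx)
    (abs_selectionRegret_le π) ?_ fun n => (hfst n).comp (u := fun h => 2 * ‖h‖) (by fun_prop)
  exact (integrable_map_measure (by fun_prop)
    (measurable_past hE.measurable_h hE.measurable_G le_rfl).aemeasurable).2
    (hEh_int.norm.const_mul 2)
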